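/- Conventions. A \emph{dagger compact category} $\mathbf V$ is a symmetric monoidal category in which every object $A$ has a chosen dual $A^*$ with cup $\eta_A\colon I\to A^*\otimes A$ and cap $\varepsilon_A\colon A\otimes A^*\to I$ satisfying the snake equations, together with an identity-on-objects contravariant involution $\dagger$ such that $(f\otimes g)^\dagger=f^\dagger\otimes g^\dagger$, the coherence isomorphisms $\alpha,\lambda,\rho,\sigma$ are unitary, and $\sigma_{A,A^*}\circ\varepsilon_A^\dagger=\eta_A$. For $f\colon A\to B$ let $f^*\colon B^*\to A^*$ be its transpose and $f_*=(f^\dagger)^*\colon A^*\to B^*$. A map is \emph{positive} if it is of the form $h^\dagger\circ h$, and \emph{positive definite} if it is moreover invertible. $\mathbf V$ is \emph{positive-dimensional} if for every object $X$ there is a positive definite scalar $z\colon I\to I$ with $(z^2\circ \mathrm{Tr}_X(1_X))\otimes 1_X=1_X$. A \emph{normalisable dagger Frobenius algebra} in $\mathbf V$ is a monoid $(A,m,u)$ in $\mathbf V$ with $(1\otimes m)(m^\dagger\otimes 1)=m^\dagger m=(m\otimes 1)(1\otimes m^\dagger)$, for which there exists a positive definite $z\colon A\to A$ that is central, $m(z\otimes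 1)=zm=m(1\otimes z)$, and satisfies $\mathrm{Tr}_A(m)\circ z^2=u^\dagger$ (where $\mathrm{Tr}_A(m)\colon A\to I$ is the partial trace of $m$ over its second input). Let $\mathrm{act}_A=(1_{A^*}\otimes m)(\eta_A\otimes 1_A)\colon A\to A^*\otimes A$. The category $\mathbf{CP}^*[\mathbf V]$ has as objects the normalisable dagger Frobenius algebras in $\mathbf V$, and as morphisms $(A,m)\to(B,m')$ the morphisms $f\colon A\to B$ of $\mathbf V$ for which there are an object $X$ and a morphism $g\colon A\to X\otimes B$ in $\mathbf V$ with $$\mathrm{act}_B\circ f\circ \mathrm{act}_A^\dagger=(1_{B^*}\otimes \eta_X^\dagger\otimes 1_B)\circ(g_*\otimes g)\colon A^*\otimes A\to B^*\otimes B,$$ where $B^*\otimes X^*$ is used as the dual of $X\otimes B$. Composition, dagger, monoidal product, coherence isomorphisms and symmetry are those of $\mathbf V$; the monoidal product of algebras has multiplication $(m\otimes m')(1\otimes\sigma\otimes 1)$ and unit $u\otimes u'$, and the monoidal unit is $I$ with the coherence isomorphism $I\otimes I\to I$ as multiplication and $1_I$ as unit. Write $\mathcal B(A)$ for the algebra $A^*\otimes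 A$ with multiplication $1_{A^*}\otimes\varepsilon_A\otimes 1_A$ and unit $\eta_A$. Corollary. Let $\mathbf V$ be a positive-dimensional dagger compact category. Then $\mathbf{CP}^*[\mathbf V]$ is a well-defined dagger symmetric monoidal category, every $\mathcal B(A)$ is an object of it, every $f_*\otimes f$ (for $f\colon A\to B$ in $\mathbf V$) is a morphism $\mathcal B(A)\to\mathcal B(B)$ in it, and $$A\mapsto \mathcal B(A),\qquad f\mapsto f_*\otimes f$$ defines a dagger symmetric monoidal functor $\mathbf V\to\mathbf{CP}^*[\mathbf V]$: it is a functor, it commutes with the daggers, and it admits a unitary isomorphism $I\to\mathcal B(I)$ and natural unitary isomorphisms $\mathcal B(A)\otimes\mathcal B(B)\to\mathcal B(A\otimes B)$ in $\mathbf{CP}^*[\mathbf V]$ compatible with associativity, units and symmetry. -/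

import Mathlib

open CategoryTheory MonoidalCategory

universe v u

namespace DaggerCompact

/-! ### Dagger categories -/

/-- A dagger on a category: an identity-on-objects, contravariant, involutive functor. -/
class DaggerCategory (C : Type u) [Category.{v} C] where
  dag : ∀ {X Y : C}, (X ⟶ Y) → (Y ⟶ X)
  dag_id : ∀ X : C, dag (𝟙 X) = 𝟙 X
  dag_comp : ∀ {X Y Z : C} (f : X ⟶ Y) (g : Y ⟶ Z), dag (f ≫ g) = dag g ≫ dag f
  dag_dag : ∀ {X Y : C} (f : X ⟶ Y), dag (dag f) = f

/-- `f†` is the dagger of `f`. -/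
postfix:1024 "†" => DaggerCategory.dag

/-- `u : X ⟶ Y` is unitary. -/
structure IsUnitary {C : Type u} [Category.{v} C] [DaggerCategory C] {X Y : C} (f : X ⟶ Y) :
    Prop where
  comp_dag : f ≫ f† = 𝟙 X
  dag_comp : f† ≫ f = 𝟙 Y

/-- `f : X ⟶ X` is positive: `f = h† ∘ h` for some `h`. -/
def IsPositive {C : Type u} [Category.{v} C] [DaggerCategory C] {X : C} (f : X ⟶ X) : Prop :=
  ∃ (Y : C) (h : X ⟶ Y), f = h ≫ h†

/-- A positive definite map is a positive isomorphism. -/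
def IsPositiveDefinite {C : Type u} [Category.{v} C] [DaggerCategory C] {X : C} (f : X ⟶ X) :
    Prop :=
  IsPositive f ∧ IsIso f

/-- Dagger symmetric monoidal categories: the dagger is strictly compatible with the monoidal
product and the coherence isomorphisms are unitary. -/
class DaggerSymmetricMonoidalCategory (C : Type u) [Category.{v} C] [MonoidalCategory C]
    [SymmetricCategory C] [DaggerCategory C] : Prop where
  dag_tensor : ∀ {X₁ Y₁ X₂ Y₂ : C} (f : X₁ ⟶ Y₁) (g : X₂ ⟶ Y₂), (f ⊗ₘ g)† = f† ⊗ₘ g†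
  unitary_associator : ∀ X Y Z : C, IsUnitary (α_ X Y Z).hom
  unitary_leftUnitor : ∀ X : C, IsUnitary (λ_ X).hom
  unitary_rightUnitor : ∀ X : C, IsUnitary (ρ_ X).hom
  unitary_braiding : ∀ X Y : C, IsUnitary (β_ X Y).hom

section Duals

variable {V : Type u} [Category.{v} V] [MonoidalCategory V] [LeftRigidCategory V]

/-- The chosen dual `A*` of `A`; in Mathlib's terminology it is the left dual. -/
abbrev dual (A : V) : V := HasLeftDual.leftDual A

/-- The cup `η_A : I ⟶ A* ⊗ A`. Together with `cap A` it satisfies the snake equations, which are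
part of Mathlib's class `ExactPairing`. -/
abbrev cup (A : V) : 𝟙_ V ⟶ dual A ⊗ A := ExactPairing.coevaluation (dual A) A

/-- The cap `ε_A : A ⊗ A* ⟶ I`. -/
abbrev cap (A : V) : A ⊗ dual A ⟶ 𝟙_ V := ExactPairing.evaluation (dual A) A

end Duals

/-- Dagger compact categories: compact categories, i.e. symmetric monoidal categories with chosen
duals, that are dagger symmetric monoidal, and where cup and cap are interchanged by the dagger
(up to the symmetry): `σ ∘ ε_A† = η_A`. -/
class DaggerCompactCategory (V : Type u) [Category.{v} V] [MonoidalCategory V]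
    [SymmetricCategory V] [LeftRigidCategory V] [DaggerCategory V] : Prop
    extends DaggerSymmetricMonoidalCategory V where
  dag_cap : ∀ A : V, (cap A)† ≫ (β_ A (dual A)).hom = cup A

/-- A dagger symmetric monoidal structure on a functor: a (strong) symmetric monoidal structure
with unitary structure maps, where the functor commutes with the daggers. -/
class DaggerSymmetricMonoidalFunctor {C D : Type*} [Category C] [MonoidalCategory C]
    [SymmetricCategory C] [DaggerCategory C] [DaggerSymmetricMonoidalCategory C]
    [Category D] [MonoidalCategory D] [SymmetricCategory D] [DaggerCategory D]
    [DaggerSymmetricMonoidalCategory D] (F : C ⥤ D) extends F.Braided where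
  map_dag : ∀ {X Y : C} (f : X ⟶ Y), F.map (f†) = (F.map f)†
  unitary_unit : IsUnitary (Functor.LaxMonoidal.ε F)
  unitary_tensor : ∀ X Y : C, IsUnitary (Functor.LaxMonoidal.μ F X Y)

section Algebras

variable {V : Type u} [Category.{v} V] [MonoidalCategory V] [SymmetricCategory V]
  [LeftRigidCategory V] [DaggerCategory V]

/-- The partial trace over `U` of `f : A ⊗ U ⟶ B ⊗ U`. -/
def partialTrace {A B U : V} (f : A ⊗ U ⟶ B ⊗ U) : A ⟶ B :=
  (ρ_ A).inv ≫ A ◁ (cup U ≫ (β_ (dual U) U).hom) ≫ (α_ A U (dual U)).inv ≫ f ▷ dual U ≫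
    (α_ B U (dual U)).hom ≫ B ◁ cap U ≫ (ρ_ B).hom

/-- The dimension `Tr_X(1_X)` of an object, a scalar. -/
def dimension (X : V) : 𝟙_ V ⟶ 𝟙_ V := partialTrace (𝟙 (𝟙_ V ⊗ X))

variable (V) in
/-- Positive-dimensional categories: for each object `X` there is a positive definite scalar `z`
such that `(z² ∘ Tr_X(1_X)) ⊗ 1_X = 1_X`. -/
def IsPositiveDimensional : Prop :=
  ∀ X : V, ∃ z : 𝟙_ V ⟶ 𝟙_ V, IsPositiveDefinite z ∧ (dimension X ≫ z ≫ z) ▷ X = 𝟙 (𝟙_ V ⊗ X)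

/-- The multiplication of an algebra, with explicit name. -/
abbrev mult (A : V) [MonObj A] : A ⊗ A ⟶ A := MonObj.mul

/-- The unit of an algebra, with explicit name. -/
abbrev unit (A : V) [MonObj A] : 𝟙_ V ⟶ A := MonObj.one

/-- A dagger Frobenius algebra: a monoid whose multiplication `m` satisfies the Frobenius law
`(1 ⊗ m) ∘ (m† ⊗ 1) = m† ∘ m = (m ⊗ 1) ∘ (1 ⊗ m†)`. -/
structure IsDaggerFrobenius (A : V) [MonObj A] : Prop where
  frobenius_left : (mult A)† ▷ A ≫ (α_ A A A).hom ≫ A ◁ mult A = mult A ≫ (mult A)†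
  frobenius_right : A ◁ (mult A)† ≫ (α_ A A A).inv ≫ mult A ▷ A = mult A ≫ (mult A)†

/-- A map `z : A ⟶ A` is central: `m ∘ (z ⊗ 1) = z ∘ m = m ∘ (1 ⊗ z)`. -/
structure IsCentral {A : V} [MonObj A] (z : A ⟶ A) : Prop where
  left : z ▷ A ≫ mult A = mult A ≫ z
  right : A ◁ z ≫ mult A = mult A ≫ z

/-- The trace `Tr_A(m) : A ⟶ I` of the multiplication. -/
def multTrace (A : V) [MonObj A] : A ⟶ 𝟙_ V :=
  partialTrace (mult A ≫ (λ_ A).inv)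

/-- Normalisability: `Tr_A(m) ∘ z² ` is the counit for some central, positive definite `z`. -/
def IsNormalisable (A : V) [MonObj A] : Prop :=
  ∃ z : A ⟶ A, IsCentral z ∧ IsPositiveDefinite z ∧ z ≫ z ≫ multTrace A = (unit A)†

/-- Abstract C*-algebras: normalisable dagger Frobenius algebras. -/
structure IsAbstractCStarAlgebra (A : V) [MonObj A] : Prop where
  frobenius : IsDaggerFrobenius A
  normalisable : IsNormalisable A

/-- The action `A ⟶ A* ⊗ A` of an algebra: the multiplication with its left input bent up. -/
def action (A : V) [MonObj A] : A ⟶ dual A ⊗ A :=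
  (λ_ A).inv ≫ cup A ▷ A ≫ (α_ (dual A) A A).hom ≫ dual A ◁ mult A

/-- The coaction `A* ⊗ A ⟶ A`: the comultiplication with its left output bent down. -/
def coaction (A : V) [MonObj A] : dual A ⊗ A ⟶ A :=
  dual A ◁ (mult A)† ≫ (α_ (dual A) A A).inv ≫ (cup A)† ▷ A ≫ (λ_ A).hom

/-- The conjugate `f_* = (f†)^* : A* ⟶ B*` of `f : A ⟶ B`. -/
def conjugate {A B : V} (f : A ⟶ B) : dual A ⟶ dual B := leftAdjointMate (f†)

/-- The conjugate `g_* : A* ⟶ B* ⊗ X*` of `g : A ⟶ X ⊗ B`, where `B* ⊗ X*` (with nested cup and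
cap) is used as dual of `X ⊗ B`. -/
def conjugateTensor {A X B : V} (g : A ⟶ X ⊗ B) : dual A ⟶ dual B ⊗ dual X :=
  @leftAdjointMate V _ _ (X ⊗ B) A hasLeftDualTensor _ (g†)

/-- The map `A* ⊗ A ⟶ B* ⊗ B` obtained from `g_* ⊗ g` by contracting the wire `X`. -/
def krausForm {A X B : V} (g : A ⟶ X ⊗ B) : (dual A ⊗ A) ⟶ dual B ⊗ B :=
  (conjugateTensor g ⊗ₘ g) ≫ (α_ (dual B) (dual X) (X ⊗ B)).hom ≫
    dual B ◁ ((α_ (dual X) X B).inv ≫ (cup X)† ▷ B ≫ (λ_ B).hom)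

/-- The CP*-condition for a map between algebras. -/
def IsCPStar {A B : V} [MonObj A] [MonObj B] (f : A ⟶ B) : Prop :=
  ∃ (X : V) (g : A ⟶ X ⊗ B), coaction A ≫ f ≫ action B = krausForm g

end Algebras

/-! ### The category CP*[V] -/

section CPStar

variable (V : Type u) [Category.{v} V] [MonoidalCategory V] [SymmetricCategory V]
  [LeftRigidCategory V] [DaggerCategory V]

/-- The objects of `CP*[V]`: normalisable dagger Frobenius algebras in `V`. -/
structure CPStar where
  X : V
  [mon : MonObj X]
  isAlgebra : IsAbstractCStarAlgebra X

attribute [instance] CPStar.mon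

/-- The assertion that the abstract C*-algebras and the maps satisfying the CP*-condition form a
dagger symmetric monoidal category under the operations of `V`, that is, that they are closed under
all these operations. The laws themselves hold since they hold in `V`. The tensor product of two
algebras carries the multiplication `(m ⊗ m) ∘ (1 ⊗ σ ⊗ 1)` and the unit `u ⊗ u`; the monoidal unit
carries the coherence isomorphism as multiplication (these are Mathlib's instances of `MonObj`). -/
class CPStarWellDefined : Prop where
  id_mem : ∀ A : CPStar V, IsCPStar (𝟙 A.X)
  comp_mem : ∀ {A B C : CPStar V} (f : A.X ⟶ B.X) (g : B.X ⟶ C.X),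
    IsCPStar f → IsCPStar g → IsCPStar (f ≫ g)
  dag_mem : ∀ {A B : CPStar V} (f : A.X ⟶ B.X), IsCPStar f → IsCPStar (f†)
  unit_isAlgebra : IsAbstractCStarAlgebra (𝟙_ V)
  tensor_isAlgebra : ∀ A B : CPStar V, IsAbstractCStarAlgebra (A.X ⊗ B.X)
  tensor_mem : ∀ {A B C D : CPStar V} (f : A.X ⟶ B.X) (g : C.X ⟶ D.X),
    IsCPStar f → IsCPStar g → IsCPStar (f ⊗ₘ g)
  associator_mem : ∀ A B C : CPStar V, IsCPStar (α_ A.X B.X C.X).hom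
  associator_inv_mem : ∀ A B C : CPStar V, IsCPStar (α_ A.X B.X C.X).inv
  leftUnitor_mem : ∀ A : CPStar V, IsCPStar (λ_ A.X).hom
  leftUnitor_inv_mem : ∀ A : CPStar V, IsCPStar (λ_ A.X).inv
  rightUnitor_mem : ∀ A : CPStar V, IsCPStar (ρ_ A.X).hom
  rightUnitor_inv_mem : ∀ A : CPStar V, IsCPStar (ρ_ A.X).inv
  braiding_mem : ∀ A B : CPStar V, IsCPStar (β_ A.X B.X).hom

namespace CPStar

variable {V}

/-- The morphisms of `CP*[V]`: morphisms of `V` satisfying the CP*-condition. -/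
@[ext]
structure Hom (A B : CPStar V) where
  hom : A.X ⟶ B.X
  mem : IsCPStar hom

variable [CPStarWellDefined V]

instance category : Category (CPStar V) where
  Hom A B := Hom A B
  id A := ⟨𝟙 A.X, CPStarWellDefined.id_mem A⟩
  comp f g := ⟨f.hom ≫ g.hom, CPStarWellDefined.comp_mem f.hom g.hom f.mem g.mem⟩
  id_comp f := Hom.ext (Category.id_comp f.hom)
  comp_id f := Hom.ext (Category.comp_id f.hom)
  assoc f g h := Hom.ext (Category.assoc f.hom g.hom h.hom)

@[ext]
theorem hom_ext {A B : CPStar V} {f g : A ⟶ B} (h : f.hom = g.hom) : f = g := Hom.ext h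

@[simp]
theorem id_hom (A : CPStar V) : Hom.hom (𝟙 A) = 𝟙 A.X := rfl

@[simp]
theorem comp_hom {A B C : CPStar V} (f : A ⟶ B) (g : B ⟶ C) :
    Hom.hom (f ≫ g) = f.hom ≫ g.hom := rfl

/-- Isomorphisms of `V` that satisfy the CP*-condition in both directions. -/
@[simps]
def mkIso {A B : CPStar V} (e : A.X ≅ B.X) (h : IsCPStar e.hom) (h' : IsCPStar e.inv) : A ≅ B where
  hom := ⟨e.hom, h⟩
  inv := ⟨e.inv, h'⟩
  hom_inv_id := hom_ext e.hom_inv_id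
  inv_hom_id := hom_ext e.inv_hom_id

/-- Daggers in `CP*[V]` are those of `V`. -/
instance dagger : DaggerCategory (CPStar V) where
  dag f := ⟨f.hom†, CPStarWellDefined.dag_mem f.hom f.mem⟩
  dag_id A := hom_ext (DaggerCategory.dag_id A.X)
  dag_comp f g := hom_ext (DaggerCategory.dag_comp f.hom g.hom)
  dag_dag f := hom_ext (DaggerCategory.dag_dag f.hom)

instance monoidalStruct : MonoidalCategoryStruct (CPStar V) where
  tensorObj A B := ⟨A.X ⊗ B.X, CPStarWellDefined.tensor_isAlgebra A B⟩
  tensorUnit := ⟨𝟙_ V, CPStarWellDefined.unit_isAlgebra⟩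
  tensorHom f g := ⟨f.hom ⊗ₘ g.hom, CPStarWellDefined.tensor_mem f.hom g.hom f.mem g.mem⟩
  whiskerLeft A _ _ f := ⟨A.X ◁ f.hom, by
    rw [← id_tensorHom]
    exact CPStarWellDefined.tensor_mem _ _ (CPStarWellDefined.id_mem A) f.mem⟩
  whiskerRight f B := ⟨f.hom ▷ B.X, by
    rw [← tensorHom_id]
    exact CPStarWellDefined.tensor_mem _ _ f.mem (CPStarWellDefined.id_mem B)⟩
  associator A B C := mkIso (α_ A.X B.X C.X) (CPStarWellDefined.associator_mem A B C)
    (CPStarWellDefined.associator_inv_mem A B C)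
  leftUnitor A := mkIso (λ_ A.X) (CPStarWellDefined.leftUnitor_mem A)
    (CPStarWellDefined.leftUnitor_inv_mem A)
  rightUnitor A := mkIso (ρ_ A.X) (CPStarWellDefined.rightUnitor_mem A)
    (CPStarWellDefined.rightUnitor_inv_mem A)

/-- The monoidal structure of `CP*[V]` is that of `V`. -/
instance monoidal : MonoidalCategory (CPStar V) where
  tensorHom_def f g := hom_ext (tensorHom_def f.hom g.hom)
  id_tensorHom_id A B := hom_ext (id_tensorHom_id A.X B.X)
  tensorHom_comp_tensorHom f₁ f₂ g₁ g₂ :=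
    hom_ext (tensorHom_comp_tensorHom f₁.hom f₂.hom g₁.hom g₂.hom)
  whiskerLeft_id A B := hom_ext (MonoidalCategory.whiskerLeft_id A.X B.X)
  id_whiskerRight A B := hom_ext (MonoidalCategory.id_whiskerRight A.X B.X)
  associator_naturality f g h := hom_ext (associator_naturality f.hom g.hom h.hom)
  leftUnitor_naturality f := hom_ext (leftUnitor_naturality f.hom)
  rightUnitor_naturality f := hom_ext (rightUnitor_naturality f.hom)
  pentagon A B C D := hom_ext (pentagon A.X B.X C.X D.X)
  triangle A B := hom_ext (triangle A.X B.X)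

/-- The symmetry of `CP*[V]` is that of `V`. -/
instance symmetric : SymmetricCategory (CPStar V) where
  braiding A B := mkIso (β_ A.X B.X) (CPStarWellDefined.braiding_mem A B) (by
    rw [← SymmetricCategory.braiding_swap_eq_inv_braiding]
    exact CPStarWellDefined.braiding_mem B A)
  braiding_naturality_right A _ _ f :=
    hom_ext (BraidedCategory.braiding_naturality_right A.X f.hom)
  braiding_naturality_left f A :=
    hom_ext (BraidedCategory.braiding_naturality_left f.hom A.X)
  hexagon_forward A B C := hom_ext (BraidedCategory.hexagon_forward A.X B.X C.X)
  hexagon_reverse A B C := hom_ext (BraidedCategory.hexagon_reverse A.X B.X C.X)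
  symmetry A B := hom_ext (SymmetricCategory.symmetry A.X B.X)

instance daggerSymmetricMonoidal [DaggerSymmetricMonoidalCategory V] :
    DaggerSymmetricMonoidalCategory (CPStar V) where
  dag_tensor f g := hom_ext (DaggerSymmetricMonoidalCategory.dag_tensor f.hom g.hom)
  unitary_associator A B C :=
    ⟨hom_ext (DaggerSymmetricMonoidalCategory.unitary_associator A.X B.X C.X).comp_dag,
      hom_ext (DaggerSymmetricMonoidalCategory.unitary_associator A.X B.X C.X).dag_comp⟩
  unitary_leftUnitor A :=
    ⟨hom_ext (DaggerSymmetricMonoidalCategory.unitary_leftUnitor A.X).comp_dag,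
      hom_ext (DaggerSymmetricMonoidalCategory.unitary_leftUnitor A.X).dag_comp⟩
  unitary_rightUnitor A :=
    ⟨hom_ext (DaggerSymmetricMonoidalCategory.unitary_rightUnitor A.X).comp_dag,
      hom_ext (DaggerSymmetricMonoidalCategory.unitary_rightUnitor A.X).dag_comp⟩
  unitary_braiding A B :=
    ⟨hom_ext (DaggerSymmetricMonoidalCategory.unitary_braiding A.X B.X).comp_dag,
      hom_ext (DaggerSymmetricMonoidalCategory.unitary_braiding A.X B.X).dag_comp⟩

end CPStar

end CPStar

/-! ### Abstract matrix algebras and the functor -/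

section Pure

variable {V : Type u} [Category.{v} V] [MonoidalCategory V] [SymmetricCategory V]
  [LeftRigidCategory V] [DaggerCategory V]

/-- The multiplication `(H* ⊗ H) ⊗ (H* ⊗ H) ⟶ H* ⊗ H` that applies the cap to the two middle
factors. -/
def pantsMult (H : V) : (dual H ⊗ H) ⊗ (dual H ⊗ H) ⟶ (dual H ⊗ H) :=
  (α_ (dual H) H (dual H ⊗ H)).hom ≫
    dual H ◁ ((α_ H (dual H) H).inv ≫ cap H ▷ H ≫ (λ_ H).hom)

/-- The monoid `H* ⊗ H`, with the cup as unit. -/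
@[reducible]
def pantsMonObj (H : V) : MonObj (dual H ⊗ H) where
  one := cup H
  mul := pantsMult H
  one_mul := by
    have h := ExactPairing.evaluation_coevaluation (dual H) H
    calc
      _ = 𝟙 _ ⊗≫ (cup H ▷ dual H ≫ (α_ (dual H) H (dual H)).hom ≫ dual H ◁ cap H) ▷ H ⊗≫ 𝟙 _ := by
        dsimp only [pantsMult]; monoidal
      _ = _ := by rw [h]; monoidal
  mul_one := by
    have h := ExactPairing.coevaluation_evaluation (dual H) H
    calc
      _ = 𝟙 _ ⊗≫ dual H ◁ (H ◁ cup H ≫ (α_ H (dual H) H).inv ≫ cap H ▷ H) ⊗≫ 𝟙 _ := by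
        dsimp only [pantsMult]; monoidal
      _ = _ := by rw [h]; monoidal
  mul_assoc := by
    calc
      _ = 𝟙 _ ⊗≫ dual H ◁ (cap H ▷ (H ⊗ dual H) ≫ 𝟙_ V ◁ cap H) ▷ H ⊗≫ 𝟙 _ := by
        dsimp only [pantsMult]; monoidal
      _ = 𝟙 _ ⊗≫ dual H ◁ ((H ⊗ dual H) ◁ cap H ≫ cap H ▷ 𝟙_ V) ▷ H ⊗≫ 𝟙 _ := by
        rw [whisker_exchange]
      _ = _ := by
        dsimp only [pantsMult]; monoidal

/-- `f ↦ f_* ⊗ f` as a map `A* ⊗ A ⟶ B* ⊗ B`. -/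
def double {A B : V} (f : A ⟶ B) : dual A ⊗ A ⟶ dual B ⊗ B := conjugate f ⊗ₘ f

theorem double_id (A : V) : double (𝟙 A) = 𝟙 (dual A ⊗ A) := by
  simp [double, conjugate, DaggerCategory.dag_id]

theorem double_comp {A B C : V} (f : A ⟶ B) (g : B ⟶ C) :
    double (f ≫ g) = double f ≫ double g := by
  simp [double, conjugate, DaggerCategory.dag_comp, comp_leftAdjointMate]

variable (V) in
/-- The assertion that the algebra `H* ⊗ H` is an abstract C*-algebra for each object `H`. -/
def HasMatrixAlgebras : Prop :=
  ∀ H : V, @IsAbstractCStarAlgebra V _ _ _ _ _ (dual H ⊗ H) (pantsMonObj H)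

/-- The abstract matrix algebra `B(H) = H* ⊗ H`, as an object of `CP*[V]`. -/
def matrixAlgebra (hB : HasMatrixAlgebras V) (H : V) : CPStar V where
  X := dual H ⊗ H
  mon := pantsMonObj H
  isAlgebra := hB H

/-- The functor `V ⥤ CP*[V]` given by `A ↦ B(A)` and `f ↦ f_* ⊗ f`. -/
def pureFunctor [CPStarWellDefined V] (hB : HasMatrixAlgebras V)
    (hf : ∀ {A B : V} (f : A ⟶ B),
      IsCPStar (A := (matrixAlgebra hB A).X) (B := (matrixAlgebra hB B).X) (double f)) :
    V ⥤ CPStar V where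
  obj A := matrixAlgebra hB A
  map f := ⟨double f, hf f⟩
  map_id A := CPStar.hom_ext (double_id A)
  map_comp f g := CPStar.hom_ext (double_comp f g)

end Pure

end DaggerCompact

/-! The doubling `H ↦ H* ⊗ H`, `f ↦ f_* ⊗ f` is a symmetric monoidal functor `V ⥤ V` with unitary
structure maps `cup (𝟙_ V)` and `doubleTensor`. Its coherence laws reduce to those of the comparison
`conjTensor : A* ⊗ B* ⟶ (A ⊗ B)*`, which are checked by evaluating against caps (`hom_ext_cap`). The
laws of the functor into `CP*[V]` are these same equations in `V`, so the remaining work is to show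
that the maps and algebras involved belong to `CP*[V]`.

A Kraus form is a doubled map followed by discarding an environment (`krausForm_eq`). Environments
can be discarded in stages (`discard_discard`) and in parallel (`cpmTensor_discard`), and the dagger
of a discard is a doubled map followed by a discard (`isCPM_discard_dag`). Hence completely positive
maps between doubled objects are closed under composition, monoidal product and dagger.

A map `f` between algebras satisfies the CP*-condition when `coaction ≫ f ≫ action` is completely
positive. To compose two such maps, the middle `action` and `coaction` have to be cancelled by a
completely positive map (`exists_action_double_coaction`), and normalisability enters twice. The
trace of left multiplication is symmetric and the normaliser `z` is central, so the Frobenius form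
is symmetric (`IsNormalisable.isSymmetricForm`) and `action ≫ coaction` equals `m† ≫ m`. The
normalising equation then says that `z² ≫ m† ≫ m` preserves the counit, which forces it to be the
identity because the form is nondegenerate. Symmetry also gives that `coaction ≫ action` is the
Kraus form of `m†` (`coaction_action`), so identities, and by `action_double` all unitary
homomorphisms, satisfy the condition.

For `B(H)` the map `m† ≫ m` is multiplication by the dimension of `H`, and positive-dimensionality
supplies the normaliser. The coaction of `B(H)` is a discard (`pants_coaction`), so every completely
positive map between doubled objects satisfies the CP*-condition, in particular `f_* ⊗ f`. -/

namespace DaggerCompact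

set_option linter.unusedSectionVars false

open BraidedCategory

/-! ### Symmetric monoidal preliminaries -/

section Symmetric

variable {V : Type u} [Category.{v} V] [MonoidalCategory V] [SymmetricCategory V]

/-- A wire passes through an effect on two wires. -/
theorem braiding_slide_effect (X : V) {P Q : V} (c : P ⊗ Q ⟶ 𝟙_ V) :
    (β_ X P).hom ▷ Q ≫ (α_ P X Q).hom ≫ P ◁ (β_ X Q).hom ≫ (α_ P Q X).inv ≫ c ▷ X ≫
      (λ_ X).hom = (α_ X P Q).hom ≫ X ◁ c ≫ (ρ_ X).hom := by
  have h := braiding_naturality_right X c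
  rw [braiding_tensor_right_hom] at h
  rw [← braiding_leftUnitor, ← cancel_epi (α_ X P Q).inv]
  have h' := h =≫ (λ_ X).hom
  simp only [Category.assoc] at h' ⊢
  rw [Iso.inv_hom_id_assoc, h']

theorem tensorμ_braiding (X Y Z W : V) :
    tensorμ X Y Z W ≫ (β_ (X ⊗ Z) (Y ⊗ W)).hom =
      ((β_ X Y).hom ⊗ₘ (β_ Z W).hom) ≫ tensorμ Y X W Z := by
  simp [tensorμ, SymmetricCategory.braiding_swap_eq_inv_braiding Y Z, MonoidalCategory.tensorHom_def]

theorem braiding_tensorμ (X Y Z W : V) :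
    (β_ (X ⊗ Y) (Z ⊗ W)).hom ≫ tensorμ Z W X Y =
      tensorμ X Y Z W ≫ ((β_ X Z).hom ⊗ₘ (β_ Y W).hom) := by
  simp [tensorμ, SymmetricCategory.braiding_swap_eq_inv_braiding W X, MonoidalCategory.tensorHom_def]

theorem tensorδ_eq_tensorμ (X Y Z W : V) : tensorδ X Y Z W = tensorμ X Z Y W := by
  simp [tensorμ, tensorδ, SymmetricCategory.braiding_swap_eq_inv_braiding]

end Symmetric

/-! ### Calculus of daggers -/

section Dagger

variable {V : Type u} [Category.{v} V] [DaggerCategory V]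

attribute [simp] DaggerCategory.dag_id DaggerCategory.dag_comp DaggerCategory.dag_dag

theorem dag_injective {X Y : V} {f g : X ⟶ Y} (h : f† = g†) : f = g := by
  rw [← DaggerCategory.dag_dag f, h, DaggerCategory.dag_dag]

theorem IsPositive.dag_eq {X : V} {f : X ⟶ X} (hf : IsPositive f) : f† = f := by
  obtain ⟨Y, h, rfl⟩ := hf
  simp

theorem IsUnitary.isIso {X Y : V} {f : X ⟶ Y} (hf : IsUnitary f) : IsIso f :=
  ⟨f†, hf.comp_dag, hf.dag_comp⟩

theorem IsUnitary.comp {X Y Z : V} {f : X ⟶ Y} {g : Y ⟶ Z} (hf : IsUnitary f)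
    (hg : IsUnitary g) : IsUnitary (f ≫ g) where
  comp_dag := by
    rw [DaggerCategory.dag_comp, Category.assoc, ← Category.assoc g, hg.comp_dag,
      Category.id_comp, hf.comp_dag]
  dag_comp := by
    rw [DaggerCategory.dag_comp, Category.assoc, ← Category.assoc (f†), hf.dag_comp,
      Category.id_comp, hg.dag_comp]

theorem IsUnitary.dag_hom {X Y : V} {e : X ≅ Y} (h : IsUnitary e.hom) : e.hom† = e.inv := by
  rw [← cancel_epi e.hom, h.comp_dag, e.hom_inv_id]

theorem IsUnitary.dag_inv {X Y : V} {e : X ≅ Y} (h : IsUnitary e.hom) : e.inv† = e.hom := by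
  rw [← h.dag_hom, DaggerCategory.dag_dag]

/-- A unitary map as an isomorphism with inverse its dagger. -/
def IsUnitary.iso {X Y : V} {f : X ⟶ Y} (hf : IsUnitary f) : X ≅ Y where
  hom := f
  inv := f†
  hom_inv_id := hf.comp_dag
  inv_hom_id := hf.dag_comp

variable [MonoidalCategory V] [SymmetricCategory V] [DaggerSymmetricMonoidalCategory V]

open DaggerSymmetricMonoidalCategory

attribute [simp] dag_tensor

@[simp]
theorem dag_whiskerLeft (X : V) {Y Z : V} (f : Y ⟶ Z) : (X ◁ f)† = X ◁ f† := by
  simp [← id_tensorHom]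

@[simp]
theorem dag_whiskerRight {Y Z : V} (f : Y ⟶ Z) (X : V) : (f ▷ X)† = f† ▷ X := by
  simp [← tensorHom_id]

@[simp]
theorem dag_associator_hom (X Y Z : V) : (α_ X Y Z).hom† = (α_ X Y Z).inv :=
  (unitary_associator X Y Z).dag_hom

@[simp]
theorem dag_associator_inv (X Y Z : V) : (α_ X Y Z).inv† = (α_ X Y Z).hom :=
  (unitary_associator X Y Z).dag_inv

@[simp]
theorem dag_leftUnitor_hom (X : V) : (λ_ X).hom† = (λ_ X).inv :=
  (unitary_leftUnitor X).dag_hom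

@[simp]
theorem dag_leftUnitor_inv (X : V) : (λ_ X).inv† = (λ_ X).hom :=
  (unitary_leftUnitor X).dag_inv

@[simp]
theorem dag_rightUnitor_hom (X : V) : (ρ_ X).hom† = (ρ_ X).inv :=
  (unitary_rightUnitor X).dag_hom

@[simp]
theorem dag_rightUnitor_inv (X : V) : (ρ_ X).inv† = (ρ_ X).hom :=
  (unitary_rightUnitor X).dag_inv

@[simp]
theorem dag_braiding (X Y : V) : (β_ X Y).hom† = (β_ Y X).hom := by
  rw [(unitary_braiding X Y).dag_hom, SymmetricCategory.braiding_swap_eq_inv_braiding]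

@[simp]
theorem dag_tensorμ (X Y Z W : V) : (tensorμ X Y Z W)† = tensorμ X Z Y W := by
  simp [tensorμ]

@[simp]
theorem tensorμ_tensorμ (X Y Z W : V) : tensorμ X Y Z W ≫ tensorμ X Z Y W = 𝟙 _ := by
  rw [← tensorδ_eq_tensorμ, tensorδ_tensorμ]

theorem IsUnitary.tensor {X Y Z W : V} {f : X ⟶ Y} {g : Z ⟶ W} (hf : IsUnitary f)
    (hg : IsUnitary g) : IsUnitary (f ⊗ₘ g) where
  comp_dag := by simp [hf.comp_dag, hg.comp_dag]
  dag_comp := by simp [hf.dag_comp, hg.dag_comp]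

theorem isUnitary_id (X : V) : IsUnitary (𝟙 X) := ⟨by simp, by simp⟩

theorem isUnitary_tensorμ (X Y Z W : V) : IsUnitary (tensorμ X Y Z W) :=
  ⟨by simp, by simp⟩

/-- A wire passes through a state on two wires. -/
theorem braiding_slide_state (X : V) {P Q : V} (c : 𝟙_ V ⟶ P ⊗ Q) :
    (λ_ X).inv ≫ c ▷ X ≫ (α_ P Q X).hom ≫ P ◁ (β_ Q X).hom ≫ (α_ P X Q).inv ≫
      (β_ P X).hom ▷ Q = (ρ_ X).inv ≫ X ◁ c ≫ (α_ X P Q).inv := by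
  apply dag_injective
  simpa using braiding_slide_effect X (c†)

end Dagger

/-! ### Duals -/

section Duals

variable {V : Type u} [Category.{v} V] [MonoidalCategory V] [LeftRigidCategory V]

theorem snake (A : V) :
    A ◁ cup A ≫ (α_ A (dual A) A).inv ≫ cap A ▷ A = (ρ_ A).hom ≫ (λ_ A).inv :=
  ExactPairing.coevaluation_evaluation _ _

theorem snake_dual (A : V) :
    cup A ▷ dual A ≫ (α_ (dual A) A (dual A)).hom ≫ dual A ◁ cap A =
      (λ_ (dual A)).hom ≫ (ρ_ (dual A)).inv :=
  ExactPairing.evaluation_coevaluation _ _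

/-- Maps into a dual are determined by their evaluation. -/
theorem hom_ext_cap {A Z : V} {p q : Z ⟶ dual A} (h : A ◁ p ≫ cap A = A ◁ q ≫ cap A) : p = q := by
  have h' := congrArg (tensorLeftHomEquiv Z (dual A) A (𝟙_ V)) h
  simpa only [tensorLeftHomEquiv_whiskerLeft_comp_evaluation, cancel_mono] using h'

theorem hom_ext_cup {A Z : V} {p q : dual A ⟶ Z} (h : cup A ≫ p ▷ A = cup A ≫ q ▷ A) :
    p = q := by
  have h' := congrArg (tensorRightHomEquiv (𝟙_ V) (dual A) A Z).symm h
  simpa only [tensorRightHomEquiv_symm_coevaluation_comp_whiskerRight, cancel_epi] using h'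

variable [SymmetricCategory V] [DaggerCategory V]

theorem conjugate_cap {A B : V} (f : A ⟶ B) :
    B ◁ conjugate f ≫ cap B = f† ▷ dual A ≫ cap A :=
  leftAdjointMate_comp_evaluation (f†)

theorem cup_conjugate {A B : V} (f : A ⟶ B) :
    cup A ≫ conjugate f ▷ A = cup B ≫ dual B ◁ f† :=
  coevaluation_comp_leftAdjointMate (f†)

end Duals

/-! ### Interaction of duals with the dagger -/

section DaggerDuals

variable {V : Type u} [Category.{v} V] [MonoidalCategory V] [SymmetricCategory V]
  [LeftRigidCategory V] [DaggerCategory V] [DaggerCompactCategory V]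

theorem cap_dag_braiding (A : V) : (cap A)† ≫ (β_ A (dual A)).hom = cup A :=
  DaggerCompactCategory.dag_cap A

theorem cup_braiding (A : V) : cup A ≫ (β_ (dual A) A).hom = (cap A)† := by
  rw [← cap_dag_braiding]; simp

theorem braiding_cap (A : V) : (β_ (dual A) A).hom ≫ cap A = (cup A)† := by
  rw [← cap_dag_braiding]; simp

theorem braiding_cup_dag (A : V) : (β_ A (dual A)).hom ≫ (cup A)† = cap A := by
  rw [← braiding_cap]; simp

theorem snake_dag (A : V) :
    (cap A)† ▷ A ≫ (α_ A (dual A) A).hom ≫ A ◁ (cup A)† = (λ_ A).hom ≫ (ρ_ A).inv := by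
  apply dag_injective
  simp

/-- The dagger exchanges the two ways of characterising a mate: `cup_conjugate` for `f`, with its
cups rewritten as braided daggers of caps, is the dagger of the equation that determines `conjugate
(f†)`. -/
theorem conjugate_dag {A B : V} (f : A ⟶ B) : conjugate (f†) = (conjugate f)† := by
  apply hom_ext_cap
  rw [conjugate_cap, DaggerCategory.dag_dag]
  apply dag_injective
  have h := cup_conjugate f
  rw [← cap_dag_braiding, ← cap_dag_braiding, Category.assoc, Category.assoc,
    ← braiding_naturality_right, ← braiding_naturality_left, ← Category.assoc, ← Category.assoc,
    cancel_mono] at h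
  simpa using h.symm

theorem double_dag {A B : V} (f : A ⟶ B) : double (f†) = (double f)† := by
  simp [double, conjugate_dag]

end DaggerDuals

/-! ### The conjugation functor -/

section Conjugation

variable {V : Type u} [Category.{v} V] [MonoidalCategory V] [SymmetricCategory V]
  [LeftRigidCategory V]

/-- The comparison `A* ⊗ B* ⟶ (A ⊗ B)*`. -/
def conjTensor (A B : V) : dual A ⊗ dual B ⟶ dual (A ⊗ B) :=
  (β_ (dual A) (dual B)).hom ≫ (leftDualTensorIso A B).inv

/-- The inverse of `leftDualTensorIso` is the mate of the identity for two different duals of `A ⊗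
B`, so it carries the nested cap to the chosen one. -/
theorem nestedDual_cap (A B : V) :
    (A ⊗ B) ◁ (leftDualTensorIso A B).inv ≫ cap (A ⊗ B) =
      (α_ A B _).hom ≫ A ◁ ((α_ B (dual B) (dual A)).inv ≫ cap B ▷ dual A ≫ (λ_ (dual A)).hom) ≫
        cap A := by
  have h := @leftAdjointMate_comp_evaluation V _ _ (A ⊗ B) (A ⊗ B) _ hasLeftDualTensor (𝟙 _)
  rw [id_whiskerRight, Category.id_comp] at h
  have e : ExactPairing.evaluation (dual B ⊗ dual A) (A ⊗ B) = (α_ A B _).hom ≫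
      A ◁ ((α_ B (dual B) (dual A)).inv ≫ cap B ▷ dual A ≫ (λ_ (dual A)).hom) ≫ cap A := by
    rw [ExactPairing.tensor_evaluation]
    simp [monoidalComp]
  exact h.trans e

theorem cup_nestedDual (A B : V) :
    (cup B ≫ dual B ◁ ((λ_ B).inv ≫ cup A ▷ B ≫ (α_ (dual A) A B).hom) ≫
      (α_ (dual B) (dual A) (A ⊗ B)).inv) ≫ (leftDualTensorIso A B).inv ▷ (A ⊗ B) =
      cup (A ⊗ B) := by
  have h := @coevaluation_comp_leftAdjointMate V _ _ (A ⊗ B) (A ⊗ B) _ hasLeftDualTensor (𝟙 _)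
  rw [whiskerLeft_id, Category.comp_id] at h
  have e : ExactPairing.coevaluation (dual B ⊗ dual A) (A ⊗ B) =
      cup B ≫ dual B ◁ ((λ_ B).inv ≫ cup A ▷ B ≫ (α_ (dual A) A B).hom) ≫
        (α_ (dual B) (dual A) (A ⊗ B)).inv := by
    rw [ExactPairing.tensor_coevaluation]
    simp [monoidalComp]
  exact (congrArg (· ≫ (leftDualTensorIso A B).inv ▷ (A ⊗ B)) e.symm).trans h

/-- The braiding in `conjTensor` undoes the nesting: sliding the wire `A*` past the cap of `B`
places the two caps side by side. This equation determines `conjTensor` and drives its coherence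
laws. -/
theorem conjTensor_cap (A B : V) :
    (A ⊗ B) ◁ conjTensor A B ≫ cap (A ⊗ B) =
      tensorμ A B (dual A) (dual B) ≫ (cap A ⊗ₘ cap B) ≫ (λ_ (𝟙_ V)).hom := by
  have h := braiding_slide_effect (dual A) (cap B)
  calc
    _ = 𝟙 _ ⊗≫ A ◁ (B ◁ (β_ (dual A) (dual B)).hom ≫ (α_ _ _ _).inv ≫ cap B ▷ dual A ≫
          (λ_ (dual A)).hom) ≫ cap A := by
      rw [conjTensor, whiskerLeft_comp, Category.assoc, nestedDual_cap]
      monoidal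
    _ = 𝟙 _ ⊗≫ A ◁ ((β_ B (dual A)).hom ▷ dual B ≫ ((β_ (dual A) B).hom ▷ dual B ≫
          (α_ _ _ _).hom ≫ B ◁ (β_ (dual A) (dual B)).hom ≫ (α_ _ _ _).inv ≫ cap B ▷ dual A ≫
          (λ_ (dual A)).hom)) ≫ cap A := by
      rw [← comp_whiskerRight_assoc, SymmetricCategory.symmetry]
      monoidal
    _ = _ := by
      rw [h, tensorμ, tensorHom_def']
      monoidal

variable [DaggerCategory V] [DaggerCompactCategory V]

theorem cup_conjTensor (A B : V) :
    (cup A ⊗ₘ cup B) ≫ tensorμ (dual A) A (dual B) B ≫ conjTensor A B ▷ (A ⊗ B) =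
      (λ_ (𝟙_ V)).hom ≫ cup (A ⊗ B) := by
  have h := braiding_slide_state (dual B) (cup A)
  calc
    _ = 𝟙 _ ⊗≫ cup B ⊗≫ ((λ_ (dual B)).inv ≫ cup A ▷ dual B ≫ (α_ _ _ _).hom ≫
          dual A ◁ (β_ A (dual B)).hom ≫ (α_ _ _ _).inv ≫ (β_ (dual A) (dual B)).hom ▷ A) ▷ B ⊗≫
          (leftDualTensorIso A B).inv ▷ (A ⊗ B) := by
      rw [conjTensor, tensorμ, tensorHom_def', comp_whiskerRight]
      monoidal
    _ = _ := by
      rw [h, ← cup_nestedDual]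
      monoidal

theorem comp_tensorHom_left {A B C D E : V} (f : A ⟶ B) (g : B ⟶ C) (h : D ⟶ E) :
    (f ≫ g) ⊗ₘ h = f ▷ D ≫ (g ⊗ₘ h) := by
  simp [MonoidalCategory.tensorHom_def]

theorem comp_tensorHom_right {A B C D E : V} (h : D ⟶ E) (f : A ⟶ B) (g : B ⟶ C) :
    h ⊗ₘ (f ≫ g) = D ◁ f ≫ (h ⊗ₘ g) := by
  simp [tensorHom_def']

theorem isUnitary_conjTensor (A B : V) : IsUnitary (conjTensor A B) := by
  have h : (conjTensor A B)† ≫ conjTensor A B = 𝟙 _ := by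
    apply hom_ext_cap
    -- Daggering the cup equation and prefixing a braiding gives the cap equation for the dagger of
    -- `conjTensor`.
    have e := congrArg (fun f => (β_ (A ⊗ B) _).hom ≫ f†) (cup_conjTensor A B)
    simp only [DaggerCategory.dag_comp, dag_whiskerRight, dag_tensorμ,
      DaggerSymmetricMonoidalCategory.dag_tensor, dag_leftUnitor_hom, Category.assoc,
      reassoc_of% braiding_cup_dag, ← braiding_naturality_right_assoc] at e
    rw [reassoc_of% braiding_tensorμ A B, tensorHom_comp_tensorHom, braiding_cup_dag,
      braiding_cup_dag] at e
    rw [whiskerLeft_id, Category.id_comp, whiskerLeft_comp, Category.assoc, conjTensor_cap,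
      reassoc_of% e, Iso.inv_hom_id, Category.comp_id]
  -- An isomorphism with a one-sided inverse has it as its two-sided inverse.
  have : IsIso (conjTensor A B) := by
    rw [conjTensor]
    infer_instance
  refine ⟨?_, h⟩
  rw [← cancel_mono (conjTensor A B), Category.assoc, h, Category.id_comp, Category.comp_id]

/-- After evaluation against caps only naturality of `tensorμ` remains; braiding, associativity and
unitality below follow the same pattern. -/
theorem conjTensor_natural {A B A' B' : V} (f : A ⟶ A') (g : B ⟶ B') :
    (conjugate f ⊗ₘ conjugate g) ≫ conjTensor A' B' = conjTensor A B ≫ conjugate (f ⊗ₘ g) := by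
  apply hom_ext_cap
  have h := tensorμ_natural_right A' B' (conjugate f) (conjugate g)
  have h' := tensorμ_natural_left (f†) (g†) (dual A) (dual B)
  simp only [whiskerLeft_comp, Category.assoc, conjTensor_cap, conjugate_cap,
    DaggerSymmetricMonoidalCategory.dag_tensor]
  rw [reassoc_of% h, whisker_exchange_assoc, conjTensor_cap, reassoc_of% h',
    tensorHom_comp_tensorHom_assoc, tensorHom_comp_tensorHom_assoc, conjugate_cap, conjugate_cap]

theorem conjTensor_braiding (A B : V) :
    conjTensor A B ≫ conjugate (β_ A B).hom =
      (β_ (dual A) (dual B)).hom ≫ conjTensor B A := by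
  apply hom_ext_cap
  simp only [whiskerLeft_comp, Category.assoc, conjTensor_cap, conjugate_cap, dag_braiding]
  rw [whisker_exchange_assoc, conjTensor_cap]
  have h := tensorμ_braiding A B (dual A) (dual B) =≫ ((cap B ⊗ₘ cap A) ≫ (λ_ _).hom)
  have e : (β_ (𝟙_ V) (𝟙_ V)).hom = 𝟙 _ := by
    rw [braiding_tensorUnit_left, unitors_equal, Iso.hom_inv_id]
  rw [Category.assoc, Category.assoc, ← braiding_naturality_assoc, e, Category.id_comp] at h
  rw [h, MonoidalCategory.tensorHom_def, Category.assoc, ← comp_whiskerRight_assoc, SymmetricCategory.symmetry]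
  simp

theorem conjTensor_associativity (A B C : V) :
    conjTensor A B ▷ dual C ≫ conjTensor (A ⊗ B) C ≫ conjugate (α_ A B C).hom =
      (α_ (dual A) (dual B) (dual C)).hom ≫ dual A ◁ conjTensor B C ≫ conjTensor A (B ⊗ C) := by
  apply hom_ext_cap
  have h₁ := tensorμ_natural_right (A ⊗ B) C (conjTensor A B) (𝟙 (dual C))
  have h₂ := tensorμ_natural_right A (B ⊗ C) (𝟙 (dual A)) (conjTensor B C)
  have h₃ := associator_monoidal A B C (dual A) (dual B) (dual C)
  simp only [whiskerLeft_comp, Category.assoc, conjTensor_cap, conjugate_cap,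
    dag_associator_hom]
  rw [whisker_exchange_assoc, whisker_exchange_assoc, conjTensor_cap]
  rw [tensorHom_id] at h₁
  rw [id_tensorHom] at h₂
  rw [reassoc_of% h₁, reassoc_of% h₂, tensorHom_comp_tensorHom_assoc,
    tensorHom_comp_tensorHom_assoc, conjTensor_cap, conjTensor_cap]
  rw [whiskerLeft_id, whiskerLeft_id, Category.id_comp, Category.id_comp, comp_tensorHom_left,
    comp_tensorHom_right, Category.assoc, Category.assoc]
  have e : ((cap A ⊗ₘ cap B) ≫ (λ_ (𝟙_ V)).hom ⊗ₘ cap C) ≫ (λ_ (𝟙_ V)).hom =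
      (α_ _ _ _).hom ≫ (cap A ⊗ₘ (cap B ⊗ₘ cap C) ≫ (λ_ (𝟙_ V)).hom) ≫ (λ_ (𝟙_ V)).hom := by
    monoidal
  rw [e, reassoc_of% h₃, MonoidalCategory.tensorHom_def, Category.assoc,
    ← comp_whiskerRight_assoc, Iso.inv_hom_id, id_whiskerRight, Category.id_comp]

variable (V) in
theorem unit_cap : 𝟙_ V ◁ (cup (𝟙_ V) ≫ (ρ_ _).hom) ≫ cap (𝟙_ V) = (λ_ (𝟙_ V)).hom := by
  calc
    _ = (𝟙_ V ◁ cup (𝟙_ V) ≫ (α_ _ _ _).inv ≫ cap (𝟙_ V) ▷ 𝟙_ V) ≫ (ρ_ _).hom := by monoidal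
    _ = _ := by rw [snake]; monoidal

theorem conjTensor_left_unitality (A : V) :
    (λ_ (dual A)).hom = (cup (𝟙_ V) ≫ (ρ_ _).hom) ▷ dual A ≫ conjTensor (𝟙_ V) A ≫
      conjugate (λ_ A).hom := by
  apply hom_ext_cap
  have h₁ := tensorμ_natural_right (𝟙_ V) A (cup (𝟙_ V) ≫ (ρ_ _).hom) (𝟙 (dual A))
  rw [tensorHom_id] at h₁
  simp only [whiskerLeft_comp, Category.assoc, conjugate_cap, dag_leftUnitor_hom]
  rw [whisker_exchange_assoc, whisker_exchange_assoc, conjTensor_cap, reassoc_of% h₁,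
    tensorHom_comp_tensorHom_assoc, whiskerLeft_id, Category.id_comp]
  have e' := leftUnitor_monoidal A (dual A) =≫ cap A
  rw [Category.assoc, Category.assoc, ← leftUnitor_naturality] at e'
  have e'' : ((λ_ (𝟙_ V)).hom ⊗ₘ cap A) ≫ (λ_ (𝟙_ V)).hom =
      (λ_ (𝟙_ V)).hom ▷ (A ⊗ dual A) ≫ 𝟙_ V ◁ cap A ≫ (λ_ (𝟙_ V)).hom := by
    rw [MonoidalCategory.tensorHom_def, Category.assoc]
  rw [unit_cap, e'', ← e', MonoidalCategory.tensorHom_def, Category.assoc, ← comp_whiskerRight_assoc,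
    Iso.inv_hom_id, id_whiskerRight, Category.id_comp]

variable (V) in
-- Braiding with the unit object is trivial, so the dagger of this cup is the cap up to unitors, and
-- the two snake equations become the two unitarity equations.
theorem isUnitary_cup_unit : IsUnitary (cup (𝟙_ V)) := by
  have e : (cup (𝟙_ V))† = (ρ_ _).hom ≫ (λ_ _).inv ≫ cap (𝟙_ V) := by
    rw [← braiding_cap, braiding_tensorUnit_right, Category.assoc]
  refine ⟨?_, ?_⟩
  · calc
      _ = 𝟙 _ ⊗≫ (𝟙_ V ◁ cup (𝟙_ V) ≫ (α_ _ _ _).inv ≫ cap (𝟙_ V) ▷ 𝟙_ V) ⊗≫ 𝟙 _ := by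
        rw [e]; monoidal
      _ = _ := by rw [snake]; monoidal
  · calc
      _ = 𝟙 _ ⊗≫ (𝟙_ V ◁ cap (𝟙_ V) ≫ cup (𝟙_ V) ▷ 𝟙_ V) ⊗≫ 𝟙 _ := by
        rw [e]; monoidal
      _ = 𝟙 _ ⊗≫ (cup (𝟙_ V) ▷ dual (𝟙_ V) ≫ (α_ _ _ _).hom ≫ dual (𝟙_ V) ◁ cap (𝟙_ V)) ⊗≫
          𝟙 _ := by
        rw [whisker_exchange]; monoidal
      _ = _ := by rw [snake_dual]; monoidal

end Conjugation

/-! ### The doubling functor -/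

section Doubling

variable {V : Type u} [Category.{v} V] [MonoidalCategory V] [SymmetricCategory V]
  [LeftRigidCategory V] [DaggerCategory V] [DaggerCompactCategory V]

/-- The comparison `(A* ⊗ A) ⊗ (B* ⊗ B) ⟶ (A ⊗ B)* ⊗ (A ⊗ B)`. -/
def doubleTensor (A B : V) :
    (dual A ⊗ A) ⊗ (dual B ⊗ B) ⟶ dual (A ⊗ B) ⊗ (A ⊗ B) :=
  tensorμ (dual A) A (dual B) B ≫ conjTensor A B ▷ (A ⊗ B)

theorem isUnitary_doubleTensor (A B : V) : IsUnitary (doubleTensor A B) := by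
  rw [doubleTensor, ← tensorHom_id]
  exact (isUnitary_tensorμ _ _ _ _).comp ((isUnitary_conjTensor A B).tensor (isUnitary_id _))

theorem cup_doubleTensor (A B : V) :
    (cup A ⊗ₘ cup B) ≫ doubleTensor A B = (λ_ (𝟙_ V)).hom ≫ cup (A ⊗ B) :=
  cup_conjTensor A B

theorem doubleTensor_natural {A B A' B' : V} (f : A ⟶ A') (g : B ⟶ B') :
    (double f ⊗ₘ double g) ≫ doubleTensor A' B' = doubleTensor A B ≫ double (f ⊗ₘ g) := by
  rw [doubleTensor, double, double, tensorμ_natural_assoc, doubleTensor, double, Category.assoc,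
    ← tensorHom_id, ← tensorHom_id, tensorHom_comp_tensorHom, tensorHom_comp_tensorHom,
    conjTensor_natural, Category.comp_id, Category.id_comp]

theorem doubleTensor_braiding (A B : V) :
    doubleTensor A B ≫ double (β_ A B).hom =
      (β_ (dual A ⊗ A) (dual B ⊗ B)).hom ≫ doubleTensor B A := by
  rw [doubleTensor, doubleTensor, reassoc_of% braiding_tensorμ (dual A) A (dual B) B, double,
    Category.assoc, ← tensorHom_id, ← tensorHom_id, tensorHom_comp_tensorHom,
    tensorHom_comp_tensorHom, conjTensor_braiding, Category.comp_id, Category.id_comp]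

theorem doubleTensor_associativity (A B C : V) :
    doubleTensor A B ▷ (dual C ⊗ C) ≫ doubleTensor (A ⊗ B) C ≫ double (α_ A B C).hom =
      (α_ _ _ _).hom ≫ (dual A ⊗ A) ◁ doubleTensor B C ≫ doubleTensor A (B ⊗ C) := by
  have h := tensor_associativity (dual A) A (dual B) B (dual C) C
  have h₁ := tensorμ_natural_left (conjTensor A B) (𝟙 (A ⊗ B)) (dual C) C
  have h₂ := tensorμ_natural_right (dual A) A (conjTensor B C) (𝟙 (B ⊗ C))
  rw [tensorHom_id] at h₁ h₂
  simp only [doubleTensor, double, comp_whiskerRight, whiskerLeft_comp, Category.assoc]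
  rw [reassoc_of% h₁, reassoc_of% h₂, ← reassoc_of% h,
    ← tensorHom_id (conjTensor (A ⊗ B) C), ← tensorHom_id (conjTensor A (B ⊗ C))]
  simp only [tensorHom_comp_tensorHom, id_whiskerRight, whiskerLeft_id, Category.id_comp,
    Category.comp_id, conjTensor_associativity]

theorem doubleTensor_left_unitality (A : V) :
    (λ_ (dual A ⊗ A)).hom =
      cup (𝟙_ V) ▷ (dual A ⊗ A) ≫ doubleTensor (𝟙_ V) A ≫ double (λ_ A).hom := by
  have h₁ := tensorμ_natural_left (cup (𝟙_ V) ≫ (ρ_ _).hom) (𝟙 (𝟙_ V)) (dual A) A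
  have e : cup (𝟙_ V) = (λ_ (𝟙_ V)).inv ≫ (cup (𝟙_ V) ≫ (ρ_ _).hom ⊗ₘ 𝟙 (𝟙_ V)) := by
    monoidal
  rw [e, comp_whiskerRight, Category.assoc, doubleTensor, Category.assoc, reassoc_of% h₁, double,
    ← tensorHom_id (conjTensor (𝟙_ V) A), tensorHom_comp_tensorHom, tensorHom_comp_tensorHom,
    ← conjTensor_left_unitality, tensor_left_unitality]
  simp

theorem doubleTensor_right_unitality (A : V) :
    (ρ_ (dual A ⊗ A)).hom =
      (dual A ⊗ A) ◁ cup (𝟙_ V) ≫ doubleTensor A (𝟙_ V) ≫ double (ρ_ A).hom := by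
  rw [← braiding_leftUnitor, doubleTensor_left_unitality, ← braiding_naturality_right_assoc,
    ← reassoc_of% doubleTensor_braiding, ← double_comp, braiding_leftUnitor]

variable (V) in
/-- The functor `A ↦ A* ⊗ A`, `f ↦ f_* ⊗ f`. -/
def doubleFunctor : V ⥤ V where
  obj A := dual A ⊗ A
  map f := double f
  map_id := double_id
  map_comp := double_comp

instance : (doubleFunctor V).Monoidal :=
  Functor.CoreMonoidal.toMonoidal
    { εIso := (isUnitary_cup_unit V).iso
      μIso A B := (isUnitary_doubleTensor A B).iso
      μIso_hom_natural_left f A := by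
        have h := doubleTensor_natural f (𝟙 A)
        rwa [double_id, tensorHom_id, tensorHom_id] at h
      μIso_hom_natural_right A f := by
        have h := doubleTensor_natural (𝟙 A) f
        rwa [double_id, id_tensorHom, id_tensorHom] at h
      associativity := doubleTensor_associativity
      left_unitality := doubleTensor_left_unitality
      right_unitality := doubleTensor_right_unitality }

instance : (doubleFunctor V).Braided where
  braided A B := doubleTensor_braiding A B

end Doubling

/-! ### Kraus forms and completely positive maps -/

section Kraus

variable {V : Type u} [Category.{v} V] [MonoidalCategory V] [SymmetricCategory V]
  [LeftRigidCategory V] [DaggerCategory V] 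

theorem conjugateTensor_eq {A X B : V} (g : A ⟶ X ⊗ B) :
    conjugateTensor g = conjugate g ≫ (leftDualTensorIso X B).hom := by
  have h := @comp_leftAdjointMate V _ _ (X ⊗ B) (X ⊗ B) A hasLeftDualTensor _ _ (𝟙 _) (g†)
  rw [Category.id_comp] at h
  exact h

variable [DaggerCompactCategory V]

/-- Passing `C` across the effect turns the nested contraction of a Kraus form into an effect on the
first of two doubled factors. -/
theorem effect_contraction {X : V} (B C : V) (c : dual X ⊗ X ⟶ 𝟙_ V) :
    (β_ C (dual X)).hom ▷ (X ⊗ B) ≫ tensorμ (dual X) C X B ≫ c ▷ (C ⊗ B) ≫ (λ_ (C ⊗ B)).hom =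
      (α_ C (dual X) (X ⊗ B)).hom ≫ C ◁ ((α_ (dual X) X B).inv ≫ c ▷ B ≫ (λ_ B).hom) := by
  have h := braiding_slide_effect C c
  calc
    _ = 𝟙 _ ⊗≫ ((β_ C (dual X)).hom ▷ X ≫ (α_ _ _ _).hom ≫ dual X ◁ (β_ C X).hom ≫
          (α_ _ _ _).inv ≫ c ▷ C ≫ (λ_ C).hom) ▷ B ⊗≫ 𝟙 _ := by
      rw [tensorμ]; monoidal
    _ = _ := by rw [h]; monoidal

theorem conjTensor_dag (A B : V) :
    (conjTensor A B)† = (leftDualTensorIso A B).hom ≫ (β_ (dual B) (dual A)).hom := by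
  have := (isUnitary_conjTensor A B).isIso
  rw [← cancel_epi (conjTensor A B), (isUnitary_conjTensor A B).comp_dag, conjTensor]
  simp

/-- Discarding the first factor of a doubled pair. -/
def discard (X B : V) : dual (X ⊗ B) ⊗ (X ⊗ B) ⟶ dual B ⊗ B :=
  (doubleTensor X B)† ≫ (cup X)† ▷ (dual B ⊗ B) ≫ (λ_ (dual B ⊗ B)).hom

/-- This reduces the calculus of Kraus forms to functoriality of `double` and relations between
discards. -/
theorem krausForm_eq {A X B : V} (g : A ⟶ X ⊗ B) :
    krausForm g = double g ≫ discard X B := by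
  rw [krausForm, ← effect_contraction, discard, doubleTensor, DaggerCategory.dag_comp,
    dag_tensorμ, dag_whiskerRight, conjTensor_dag, conjugateTensor_eq, double]
  simp [tensorHom_def']

/-- Since the comparison is unitary, its dagger is the oplax structure map of `doubleFunctor`. -/
theorem doubleTensor_dag_natural {A B A' B' : V} (f : A ⟶ A') (g : B ⟶ B') :
    double (f ⊗ₘ g) ≫ (doubleTensor A' B')† = (doubleTensor A B)† ≫ (double f ⊗ₘ double g) :=
  (Functor.OplaxMonoidal.δ_natural (doubleFunctor V) f g).symm

theorem doubleTensor_dag_natural_right (A : V) {B B' : V} (g : B ⟶ B') :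
    double (A ◁ g) ≫ (doubleTensor A B')† = (doubleTensor A B)† ≫ (dual A ⊗ A) ◁ double g :=
  (Functor.OplaxMonoidal.δ_natural_right (doubleFunctor V) A g).symm

theorem doubleTensor_dag_natural_left {B B' : V} (g : B ⟶ B') (A : V) :
    double (g ▷ A) ≫ (doubleTensor B' A)† = (doubleTensor B A)† ≫ double g ▷ (dual A ⊗ A) :=
  (Functor.OplaxMonoidal.δ_natural_left (doubleFunctor V) g A).symm

theorem discard_natural (X : V) {B C : V} (f : B ⟶ C) :
    double (X ◁ f) ≫ discard X C = discard X B ≫ double f := by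
  simp only [discard, Category.assoc]
  rw [reassoc_of% doubleTensor_dag_natural_right, whisker_exchange_assoc, leftUnitor_naturality]

theorem doubleTensor_cup_dag (A B : V) :
    doubleTensor A B ≫ (cup (A ⊗ B))† = ((cup A)† ⊗ₘ (cup B)†) ≫ (λ_ (𝟙_ V)).hom := by
  have h := congrArg (fun f => doubleTensor A B ≫ f†) (cup_doubleTensor A B)
  simp only [DaggerCategory.dag_comp, dag_leftUnitor_hom,
    DaggerSymmetricMonoidalCategory.dag_tensor] at h
  rw [← Category.assoc, (isUnitary_doubleTensor A B).comp_dag, Category.id_comp] at h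
  rw [h, Category.assoc, Category.assoc, Iso.inv_hom_id, Category.comp_id]

theorem double_associator_dag (X Y B : V) :
    double (α_ X Y B).inv ≫ (doubleTensor (X ⊗ Y) B)† ≫ (doubleTensor X Y)† ▷ (dual B ⊗ B) =
      (doubleTensor X (Y ⊗ B))† ≫ (dual X ⊗ X) ◁ (doubleTensor Y B)† ≫ (α_ _ _ _).inv := by
  have h := congrArg (fun f => f†) (doubleTensor_associativity X Y B)
  simp only [DaggerCategory.dag_comp, dag_whiskerLeft, dag_whiskerRight, dag_associator_hom,
    ← double_dag, Category.assoc] at h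
  exact h

theorem discard_cup_dag (X Y : V) : discard X Y ≫ (cup Y)† = (cup (X ⊗ Y))† := by
  have h : (cup (X ⊗ Y))† = (doubleTensor X Y)† ≫ ((cup X)† ⊗ₘ (cup Y)†) ≫ (λ_ (𝟙_ V)).hom := by
    rw [← doubleTensor_cup_dag, ← Category.assoc, (isUnitary_doubleTensor X Y).dag_comp,
      Category.id_comp]
  rw [h, discard, Category.assoc, Category.assoc, ← leftUnitor_naturality,
    MonoidalCategory.tensorHom_def, Category.assoc]

/-- Coherence regroups the doubled factors. Splitting and rejoining `Y ⊗ B` costs nothing by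
unitarity, and the effect on `X` commutes with the rejoining. -/
theorem discard_tensor (X Y B : V) :
    discard X (Y ⊗ B) = double (α_ X Y B).inv ≫ (doubleTensor (X ⊗ Y) B)† ≫
      discard X Y ▷ (dual B ⊗ B) ≫ doubleTensor Y B := by
  rw [discard, discard, comp_whiskerRight, comp_whiskerRight, Category.assoc, Category.assoc,
    reassoc_of% double_associator_dag]
  congr 1
  calc
    _ = 𝟙 _ ⊗≫ ((cup X)† ▷ (dual (Y ⊗ B) ⊗ Y ⊗ B) ≫ 𝟙_ V ◁ 𝟙 _) ⊗≫ 𝟙 _ := by monoidal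
    _ = 𝟙 _ ⊗≫ ((cup X)† ▷ (dual (Y ⊗ B) ⊗ Y ⊗ B) ≫
          𝟙_ V ◁ ((doubleTensor Y B)† ≫ doubleTensor Y B)) ⊗≫ 𝟙 _ := by
      rw [(isUnitary_doubleTensor Y B).dag_comp]
    _ = 𝟙 _ ⊗≫ ((cup X)† ▷ (dual (Y ⊗ B) ⊗ Y ⊗ B) ≫
          𝟙_ V ◁ (doubleTensor Y B)†) ⊗≫ doubleTensor Y B := by
      monoidal
    _ = _ := by rw [← whisker_exchange]; monoidal

theorem discard_discard (X Y B : V) :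
    discard X (Y ⊗ B) ≫ discard Y B = double (α_ X Y B).inv ≫ discard (X ⊗ Y) B := by
  rw [discard_tensor, discard.eq_def Y B, discard.eq_def (X ⊗ Y) B, ← discard_cup_dag]
  simp only [Category.assoc, comp_whiskerRight]
  rw [← Category.assoc (doubleTensor Y B), (isUnitary_doubleTensor Y B).comp_dag,
    Category.id_comp]

theorem double_leftUnitor_inv (B : V) :
    double (λ_ B).inv ≫ (doubleTensor (𝟙_ V) B)† =
      (λ_ (dual B ⊗ B)).inv ≫ cup (𝟙_ V) ▷ (dual B ⊗ B) := by
  have h := congrArg (fun f => f† ≫ cup (𝟙_ V) ▷ (dual B ⊗ B)) (doubleTensor_left_unitality B)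
  simp only [DaggerCategory.dag_comp, dag_leftUnitor_hom, dag_whiskerRight, ← double_dag,
    Category.assoc, ← comp_whiskerRight, (isUnitary_cup_unit V).dag_comp, id_whiskerRight,
    Category.comp_id] at h
  exact h.symm

theorem discard_unit (B : V) : double (λ_ B).inv ≫ discard (𝟙_ V) B = 𝟙 _ := by
  rw [discard, reassoc_of% double_leftUnitor_inv, ← comp_whiskerRight_assoc,
    (isUnitary_cup_unit V).comp_dag]
  simp

/-- Completely positive maps between doubled objects. -/
def IsCPM {A B : V} (P : dual A ⊗ A ⟶ dual B ⊗ B) : Prop :=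
  ∃ (X : V) (g : A ⟶ X ⊗ B), P = krausForm g

theorem isCPM_discard (X B : V) : IsCPM (discard X B) :=
  ⟨X, 𝟙 _, by rw [krausForm_eq, double_id, Category.id_comp]⟩

theorem isCPM_double {A B : V} (f : A ⟶ B) : IsCPM (double f) :=
  ⟨𝟙_ V, f ≫ (λ_ B).inv, by
    rw [krausForm_eq, double_comp, Category.assoc, discard_unit, Category.comp_id]⟩

theorem IsCPM.comp {A B C : V} {P : dual A ⊗ A ⟶ dual B ⊗ B} {Q : dual B ⊗ B ⟶ dual C ⊗ C}
    (hP : IsCPM P) (hQ : IsCPM Q) : IsCPM (P ≫ Q) := by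
  obtain ⟨X, g, rfl⟩ := hP
  obtain ⟨Y, h, rfl⟩ := hQ
  -- The second map acts beside the first environment, so the two environments accumulate.
  refine ⟨X ⊗ Y, g ≫ X ◁ h ≫ (α_ X Y C).inv, ?_⟩
  rw [krausForm_eq, krausForm_eq, krausForm_eq, Category.assoc, ← reassoc_of% discard_natural,
    discard_discard, double_comp, double_comp, Category.assoc, Category.assoc]

/-- The monoidal product of maps between doubled objects. -/
def cpmTensor {A B C D : V} (P : dual A ⊗ A ⟶ dual B ⊗ B) (Q : dual C ⊗ C ⟶ dual D ⊗ D) :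
    dual (A ⊗ C) ⊗ (A ⊗ C) ⟶ dual (B ⊗ D) ⊗ (B ⊗ D) :=
  (doubleTensor A C)† ≫ (P ⊗ₘ Q) ≫ doubleTensor B D

/-- An instance of the compatibility of any braided monoidal functor with `tensorμ`. -/
theorem doubleTensor_tensorμ (X Y B D : V) :
    tensorμ (dual X ⊗ X) (dual Y ⊗ Y) (dual B ⊗ B) (dual D ⊗ D) ≫
      (doubleTensor X B ⊗ₘ doubleTensor Y D) ≫ doubleTensor (X ⊗ B) (Y ⊗ D) =
      (doubleTensor X Y ⊗ₘ doubleTensor B D) ≫ doubleTensor (X ⊗ Y) (B ⊗ D) ≫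
        double (tensorμ X Y B D) :=
  tensorμ_comp_μ_tensorHom_μ_comp_μ (doubleFunctor V) X Y B D

/-- The effect discarding `X ⊗ Y` is the product of those discarding `X` and `Y`
(`doubleTensor_cup_dag`); the rest is the shuffle bringing the environments together. -/
theorem cpmTensor_discard (X B Y D : V) :
    cpmTensor (discard X B) (discard Y D) = double (tensorμ X B Y D) ≫ discard (X ⊗ Y) (B ⊗ D) := by
  have h := congrArg (fun f => f†) (doubleTensor_tensorμ X Y B D)
  simp only [DaggerCategory.dag_comp, DaggerSymmetricMonoidalCategory.dag_tensor,
    dag_tensorμ, ← double_dag, Category.assoc] at h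
  have hn := tensorμ_natural ((cup X)†) (𝟙 (dual B ⊗ B)) ((cup Y)†) (𝟙 (dual D ⊗ D))
  have hl := leftUnitor_monoidal (dual B ⊗ B) (dual D ⊗ D)
  have e' : (cup (X ⊗ Y))† ▷ (dual (B ⊗ D) ⊗ (B ⊗ D)) =
      ((doubleTensor X Y)† ⊗ₘ (doubleTensor B D)†) ≫
        (((cup X)† ⊗ₘ (cup Y)†) ⊗ₘ (𝟙 (dual B ⊗ B) ⊗ₘ 𝟙 (dual D ⊗ D))) ≫
        ((λ_ _).hom ⊗ₘ doubleTensor B D) := by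
    rw [id_tensorHom_id, tensorHom_comp_tensorHom, tensorHom_comp_tensorHom, Category.id_comp,
      (isUnitary_doubleTensor B D).dag_comp, tensorHom_id, ← doubleTensor_cup_dag,
      ← Category.assoc, (isUnitary_doubleTensor X Y).dag_comp, Category.id_comp]
  rw [discard.eq_def (X ⊗ Y), e', Category.assoc, Category.assoc, ← reassoc_of% h,
    ← reassoc_of% hn, cpmTensor, discard, discard, tensorHom_id, tensorHom_id,
    ← tensorHom_comp_tensorHom_assoc, ← tensorHom_comp_tensorHom_assoc, hl,
    MonoidalCategory.tensorHom_def (λ_ (𝟙_ V)).hom]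
  simp only [Category.assoc, leftUnitor_naturality]

theorem IsCPM.tensor {A B C D : V} {P : dual A ⊗ A ⟶ dual B ⊗ B}
    {Q : dual C ⊗ C ⟶ dual D ⊗ D} (hP : IsCPM P) (hQ : IsCPM Q) : IsCPM (cpmTensor P Q) := by
  obtain ⟨X, g, rfl⟩ := hP
  obtain ⟨Y, h, rfl⟩ := hQ
  have e : cpmTensor (krausForm g) (krausForm h) =
      double (g ⊗ₘ h) ≫ cpmTensor (discard X B) (discard Y D) := by
    simp only [cpmTensor, krausForm_eq]
    rw [reassoc_of% doubleTensor_dag_natural, tensorHom_comp_tensorHom_assoc]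
  rw [e, cpmTensor_discard]
  exact (isCPM_double _).comp ((isCPM_double _).comp (isCPM_discard _ _))

/-! ### Daggers of completely positive maps -/

theorem yank (A : V) :
    (λ_ A).inv ≫ cup A ▷ A ≫ (α_ _ _ _).hom ≫ dual A ◁ (β_ A A).hom ≫ (α_ _ _ _).inv ≫
      (cup A)† ▷ A ≫ (λ_ A).hom = 𝟙 A := by
  have h := braiding_slide_state A (cup A) =≫ (cap A ▷ A ≫ (λ_ A).hom)
  simp only [Category.assoc] at h
  rw [← comp_whiskerRight_assoc, braiding_cap, reassoc_of% snake] at h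
  rw [h]
  simp

/-- Conjugation preserves cups. -/
theorem conjugate_cup (X : V) :
    (cup (𝟙_ V) ≫ (ρ_ _).hom) ≫ conjugate (cup X) =
      cup (dual X) ≫ conjTensor (dual X) X := by
  apply hom_ext_cap
  rw [whiskerLeft_comp, Category.assoc, conjugate_cap, whisker_exchange_assoc, unit_cap,
    whiskerLeft_comp, Category.assoc, conjTensor_cap]
  have h := braiding_slide_effect X (cap (dual X))
  have hs := snake (dual X)
  calc
    _ = 𝟙 _ ⊗≫ (β_ (dual X) X).hom ⊗≫ X ◁ (dual X ◁ cup (dual X) ≫ (α_ _ _ _).inv ≫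
          cap (dual X) ▷ dual X) ⊗≫ cap X := by
      rw [hs, ← braiding_cap]; monoidal
    _ = 𝟙 _ ⊗≫ (dual X ⊗ X) ◁ cup (dual X) ⊗≫ ((β_ (dual X) X).hom ▷ dual (dual X) ≫
        (α_ X (dual X) (dual (dual X))).hom ≫ X ◁ cap (dual X) ≫ (ρ_ X).hom) ▷ dual X ⊗≫ cap X := by
      have hx := whisker_exchange (β_ (dual X) X).hom (cup (dual X))
      calc
        _ = 𝟙 _ ⊗≫ ((β_ (dual X) X).hom ▷ 𝟙_ V ≫ (X ⊗ dual X) ◁ cup (dual X)) ⊗≫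
              X ◁ cap (dual X) ▷ dual X ⊗≫ cap X := by monoidal
        _ = _ := by rw [← hx]; monoidal
    _ = _ := by
      rw [← h, tensorμ, MonoidalCategory.tensorHom_def, ← comp_whiskerRight_assoc,
        SymmetricCategory.symmetry]
      monoidal

/-- The cup of `X` is obtained from the doubled cup by discarding `X*`. -/
theorem cup_double_cup (X : V) : cup (𝟙_ V) ≫ double (cup X) ≫ discard (dual X) X = cup X := by
  have e : cup (𝟙_ V) ≫ double (cup X) =
      (λ_ (𝟙_ V)).inv ≫ ((cup (𝟙_ V) ≫ (ρ_ _).hom) ≫ conjugate (cup X) ⊗ₘ cup X) := by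
    rw [double, MonoidalCategory.tensorHom_def, MonoidalCategory.tensorHom_def]; monoidal
  have e' : (conjTensor (dual X) X ⊗ₘ 𝟙 (dual X ⊗ X)) ≫ (doubleTensor (dual X) X)† =
      tensorμ _ _ _ _ := by
    rw [doubleTensor, DaggerCategory.dag_comp, dag_whiskerRight, tensorHom_id,
      ← comp_whiskerRight_assoc, (isUnitary_conjTensor (dual X) X).comp_dag, id_whiskerRight,
      Category.id_comp, dag_tensorμ]
  have e'' : (cup (dual X) ≫ conjTensor (dual X) X ⊗ₘ cup X) =
      (cup (dual X) ⊗ₘ cup X) ≫ (conjTensor (dual X) X ⊗ₘ 𝟙 (dual X ⊗ X)) := by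
    rw [tensorHom_comp_tensorHom, Category.comp_id]
  rw [← Category.assoc, e, conjugate_cup, e'', discard, Category.assoc, Category.assoc,
    ← Category.assoc (_ ⊗ₘ 𝟙 _), e', tensorμ, tensorHom_def']
  calc
    _ = 𝟙 _ ⊗≫ cup X ⊗≫ ((λ_ (dual X)).inv ≫ cup (dual X) ▷ dual X ≫ (α_ _ _ _).hom ≫
          dual (dual X) ◁ (β_ (dual X) (dual X)).hom ≫ (α_ _ _ _).inv ≫
            (cup (dual X))† ▷ dual X ≫ (λ_ (dual X)).hom) ▷ X ⊗≫ 𝟙 _ := by monoidal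
    _ = _ := by rw [yank]; monoidal

/-- The dagger of discarding prepares the state `cup X`. By `cup_double_cup` this state is purified
by the doubled cup, with `X*` as environment. -/
theorem isCPM_discard_dag (X B : V) : IsCPM ((discard X B)†) := by
  have h : (discard X B)† = double ((λ_ B).inv ≫ cup X ▷ B ≫ (α_ (dual X) X B).hom) ≫
      discard (dual X) (X ⊗ B) := by
    rw [discard_tensor, double_comp, double_comp, Category.assoc, Category.assoc,
      ← Category.assoc (double (α_ _ _ _).hom), ← double_comp, Iso.hom_inv_id, double_id,
      Category.id_comp, reassoc_of% doubleTensor_dag_natural_left, reassoc_of% double_leftUnitor_inv,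
      ← comp_whiskerRight_assoc, ← comp_whiskerRight_assoc, Category.assoc, cup_double_cup, discard]
    simp
  rw [h]
  exact (isCPM_double _).comp (isCPM_discard _ _)

theorem IsCPM.dag {A B : V} {P : dual A ⊗ A ⟶ dual B ⊗ B} (hP : IsCPM P) : IsCPM (P†) := by
  obtain ⟨X, g, rfl⟩ := hP
  rw [krausForm_eq, DaggerCategory.dag_comp, ← double_dag]
  exact (isCPM_discard_dag X B).comp (isCPM_double _)

end Kraus

/-! ### Symmetric dagger Frobenius algebras -/

section Frobenius

variable {V : Type u} [Category.{v} V] [MonoidalCategory V] [SymmetricCategory V]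
  [LeftRigidCategory V] [DaggerCategory V] [DaggerCompactCategory V]

/-- The Frobenius form of an algebra. -/
abbrev form (A : V) [MonObj A] : A ⊗ A ⟶ 𝟙_ V := mult A ≫ (unit A)†

/-- The copairing of an algebra. -/
abbrev coform (A : V) [MonObj A] : 𝟙_ V ⟶ A ⊗ A := unit A ≫ (mult A)†

variable {A : V} [MonObj A]

theorem unit_mult : unit A ▷ A ≫ mult A = (λ_ A).hom := MonObj.one_mul A

theorem mult_unit : A ◁ unit A ≫ mult A = (ρ_ A).hom := MonObj.mul_one A

theorem mult_assoc : mult A ▷ A ≫ mult A = (α_ A A A).hom ≫ A ◁ mult A ≫ mult A :=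
  MonObj.mul_assoc A

theorem comult_counit_left : (mult A)† ≫ (unit A)† ▷ A = (λ_ A).inv := by
  have h := congrArg (fun f => f†) (unit_mult (A := A))
  simpa only [DaggerCategory.dag_comp, dag_whiskerRight, dag_leftUnitor_hom] using h

theorem comult_coassoc :
    (mult A)† ≫ (mult A)† ▷ A = (mult A)† ≫ A ◁ (mult A)† ≫ (α_ A A A).inv := by
  have h := congrArg (fun f => f†) (mult_assoc (A := A))
  simpa only [DaggerCategory.dag_comp, dag_whiskerRight, dag_whiskerLeft, dag_associator_hom,
    Category.assoc] using h

variable (A) in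
theorem coaction_eq_dag : coaction A = (action A)† := by
  simp [action, coaction]

/-- A unitary homomorphism of algebras commutes with the actions. -/
theorem action_double {B : V} [MonObj B] {f : A ⟶ B} (hf : IsUnitary f)
    (h : mult A ≫ f = (f ⊗ₘ f) ≫ mult B) : action A ≫ double f = f ≫ action B := by
  have hc := cup_conjugate f
  calc
    _ = (λ_ A).inv ≫ (cup A ≫ conjugate f ▷ A) ▷ A ≫ (α_ _ _ _).hom ≫
          dual B ◁ (mult A ≫ f) := by
      simp only [action, double, tensorHom_def', Category.assoc]
      rw [← whiskerLeft_comp_assoc, whisker_exchange]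
      monoidal
    _ = (λ_ A).inv ≫ cup B ▷ A ≫ (α_ _ _ _).hom ≫ dual B ◁ ((f† ≫ f) ▷ A ≫ B ◁ f ≫ mult B) := by
      rw [hc, h, MonoidalCategory.tensorHom_def]
      monoidal
    _ = (λ_ A).inv ≫ (cup B ▷ A ≫ (dual B ⊗ B) ◁ f) ≫ (α_ _ _ _).hom ≫ dual B ◁ mult B := by
      rw [hf.dag_comp]; monoidal
    _ = _ := by
      rw [← whisker_exchange, action]; monoidal

namespace IsDaggerFrobenius

variable (h : IsDaggerFrobenius A)
include h

theorem coform_left : (λ_ A).inv ≫ coform A ▷ A ≫ (α_ A A A).hom ≫ A ◁ mult A = (mult A)† := by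
  rw [comp_whiskerRight, Category.assoc, h.frobenius_left, reassoc_of% unit_mult, Iso.inv_hom_id_assoc]

theorem coform_right :
    (ρ_ A).inv ≫ A ◁ coform A ≫ (α_ A A A).inv ≫ mult A ▷ A = (mult A)† := by
  rw [whiskerLeft_comp, Category.assoc, h.frobenius_right, reassoc_of% mult_unit,
    Iso.inv_hom_id_assoc]

theorem form_left : A ◁ (mult A)† ≫ (α_ A A A).inv ≫ form A ▷ A ≫ (λ_ A).hom = mult A := by
  have e := h.frobenius_right =≫ ((unit A)† ▷ A ≫ (λ_ A).hom)
  simp only [Category.assoc, reassoc_of% comult_counit_left, Iso.inv_hom_id, Category.comp_id] at e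
  rw [comp_whiskerRight, Category.assoc, e]

theorem snake_form : A ◁ coform A ≫ (α_ A A A).inv ≫ form A ▷ A ≫ (λ_ A).hom = (ρ_ A).hom := by
  rw [whiskerLeft_comp, Category.assoc, h.form_left, mult_unit]

end IsDaggerFrobenius

variable (A) in
/-- The comparison of `A*` with `A` induced by the copairing. -/
def dualComparison : dual A ⟶ A :=
  (λ_ (dual A)).inv ≫ coform A ▷ dual A ≫ (α_ A A (dual A)).hom ≫ A ◁ cap A ≫ (ρ_ A).hom

theorem cup_dualComparison : cup A ≫ dualComparison A ▷ A = coform A := by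
  calc
    _ = 𝟙 _ ⊗≫ (𝟙_ V ◁ cup A ≫ coform A ▷ (dual A ⊗ A)) ⊗≫ A ◁ cap A ▷ A ⊗≫ 𝟙 _ := by
      rw [dualComparison]; monoidal
    _ = 𝟙 _ ⊗≫ coform A ⊗≫ A ◁ (A ◁ cup A ≫ (α_ _ _ _).inv ≫ cap A ▷ A) ⊗≫ 𝟙 _ := by
      rw [whisker_exchange]; monoidal
    _ = _ := by rw [snake]; monoidal

/-- Together with `cup_dualComparison`, this says that the Frobenius form and copairing make `A` its
own dual. -/
theorem dualComparison_form (h : IsDaggerFrobenius A) : A ◁ dualComparison A ≫ form A = cap A := by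
  calc
    _ = 𝟙 _ ⊗≫ A ◁ coform A ▷ dual A ⊗≫ ((A ⊗ A) ◁ cap A ≫ form A ▷ 𝟙_ V) ⊗≫ 𝟙 _ := by
      rw [dualComparison]; monoidal
    _ = 𝟙 _ ⊗≫ (A ◁ coform A ≫ (α_ A A A).inv ≫ form A ▷ A ≫ (λ_ A).hom) ▷ dual A ⊗≫ cap A := by
      rw [whisker_exchange]; monoidal
    _ = _ := by rw [h.snake_form]; monoidal

/-- The Frobenius form is symmetric. -/
def IsSymmetricForm (A : V) [MonObj A] : Prop :=
  (β_ A A).hom ≫ mult A ≫ (unit A)† = mult A ≫ (unit A)†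

theorem IsSymmetricForm.coform (hs : IsSymmetricForm A) : coform A ≫ (β_ A A).hom = coform A := by
  apply dag_injective
  simpa [IsSymmetricForm] using hs

theorem dualComparison_form' (h : IsDaggerFrobenius A) (hs : IsSymmetricForm A) :
    dualComparison A ▷ A ≫ form A = (cup A)† := by
  rw [form, ← hs, braiding_naturality_left_assoc, dualComparison_form h, braiding_cap]

theorem coaction_eq (h : IsDaggerFrobenius A) (hs : IsSymmetricForm A) :
    coaction A = dualComparison A ▷ A ≫ mult A := by
  rw [coaction, ← dualComparison_form' h hs, comp_whiskerRight, Category.assoc]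
  calc
    _ = (dual A ◁ (mult A)† ≫ dualComparison A ▷ (A ⊗ A)) ≫ (α_ _ _ _).inv ≫ form A ▷ A ≫
          (λ_ A).hom := by monoidal
    _ = _ := by rw [whisker_exchange, Category.assoc, h.form_left]

theorem action_dualComparison (h : IsDaggerFrobenius A) :
    action A ≫ dualComparison A ▷ A = (mult A)† := by
  rw [action, Category.assoc, Category.assoc, Category.assoc, whisker_exchange,
    ← h.coform_left, ← cup_dualComparison]
  monoidal

theorem action_coaction (h : IsDaggerFrobenius A) (hs : IsSymmetricForm A) :
    action A ≫ coaction A = (mult A)† ≫ mult A := by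
  rw [coaction_eq h hs, reassoc_of% action_dualComparison h]

/-- The form bends `A` back to `A*`, which gives `dualComparison` a retraction. Equations involving
actions can thus be tested after replacing `A*` by `A`. -/
theorem dualComparison_mono (h : IsDaggerFrobenius A) {Y Z : V} {f g : Z ⟶ dual A ⊗ Y}
    (e : f ≫ dualComparison A ▷ Y = g ≫ dualComparison A ▷ Y) : f = g := by
  have hχ : dualComparison A ≫ (λ_ A).inv ≫ cup A ▷ A ≫ (α_ _ _ _).hom ≫
      dual A ◁ form A ≫ (ρ_ _).hom = 𝟙 (dual A) := by
    calc
      _ = 𝟙 _ ⊗≫ (𝟙_ V ◁ dualComparison A ≫ cup A ▷ A) ⊗≫ dual A ◁ form A ⊗≫ 𝟙 _ := by monoidal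
      _ = 𝟙 _ ⊗≫ cup A ▷ dual A ⊗≫ dual A ◁ (A ◁ dualComparison A ≫ form A) ⊗≫ 𝟙 _ := by
        rw [whisker_exchange]; monoidal
      _ = (λ_ _).inv ≫ (cup A ▷ dual A ≫ (α_ _ _ _).hom ≫ dual A ◁ cap A) ≫ (ρ_ _).hom := by
        rw [dualComparison_form h]; monoidal
      _ = _ := by rw [snake_dual]; simp
  have e' := e =≫ (((λ_ A).inv ≫ cup A ▷ A ≫ (α_ _ _ _).hom ≫
      dual A ◁ form A ≫ (ρ_ _).hom) ▷ Y)
  simpa only [Category.assoc, ← comp_whiskerRight, hχ, id_whiskerRight, Category.comp_id] using e'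

/-- Composing with the cup turns every cup into a copairing, and the claim becomes coassociativity.
Nesting the duals keeps the order of the factors, so no symmetry of the form is needed. -/
theorem conjugateTensor_comult (h : IsDaggerFrobenius A) :
    conjugateTensor ((mult A)†) ≫ (dualComparison A ⊗ₘ dualComparison A) =
      dualComparison A ≫ (mult A)† := by
  apply hom_ext_cup
  rw [comp_whiskerRight, comp_whiskerRight, reassoc_of% cup_dualComparison, conjugateTensor_eq,
    comp_whiskerRight, Category.assoc, reassoc_of% cup_conjugate, DaggerCategory.dag_dag,
    ← cup_nestedDual]
  have e : dual (A ⊗ A) ◁ mult A ≫ (leftDualTensorIso A A).hom ▷ A =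
      (leftDualTensorIso A A).hom ▷ (A ⊗ A) ≫ (dual A ⊗ dual A) ◁ mult A := whisker_exchange _ _
  rw [reassoc_of% e]
  have e' : ((cup A ≫ dual A ◁ ((λ_ A).inv ≫ cup A ▷ A ≫ (α_ (dual A) A A).hom) ≫
      (α_ (dual A) (dual A) (A ⊗ A)).inv) ≫ (leftDualTensorIso A A).inv ▷ (A ⊗ A)) ≫
      (leftDualTensorIso A A).hom ▷ (A ⊗ A) =
      cup A ≫ dual A ◁ ((λ_ A).inv ≫ cup A ▷ A ≫ (α_ (dual A) A A).hom) ≫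
      (α_ (dual A) (dual A) (A ⊗ A)).inv := by
    rw [Category.assoc, ← comp_whiskerRight, Iso.inv_hom_id, id_whiskerRight, Category.comp_id]
  rw [← Category.assoc, ← Category.assoc, e', Category.assoc, whisker_exchange]
  calc
    _ = cup A ≫ (dual A ◁ ((λ_ A).inv ≫ cup A ▷ A ≫ (α_ (dual A) A A).hom) ≫
          dualComparison A ▷ (dual A ⊗ A ⊗ A)) ≫ A ◁ dualComparison A ▷ (A ⊗ A) ≫
          A ◁ A ◁ mult A ≫ (α_ _ _ _).inv := by
      rw [MonoidalCategory.tensorHom_def]; monoidal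
    _ = (cup A ≫ dualComparison A ▷ A) ≫ A ◁ ((λ_ A).inv ≫
          (cup A ≫ dualComparison A ▷ A) ▷ A ≫ (α_ A A A).hom ≫ A ◁ mult A) ≫ (α_ _ _ _).inv := by
      rw [whisker_exchange]; monoidal
    _ = _ := by
      rw [cup_dualComparison, h.coform_left, Category.assoc, comult_coassoc]

/-- The identity of a symmetric dagger Frobenius algebra is completely positive. -/
theorem coaction_action (h : IsDaggerFrobenius A) (hs : IsSymmetricForm A) :
    coaction A ≫ action A = krausForm ((mult A)†) := by
  apply dualComparison_mono h
  have e : krausForm ((mult A)†) = conjugateTensor ((mult A)†) ▷ A ≫ (α_ _ _ _).hom ≫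
      dual A ◁ coaction A := by
    rw [krausForm, coaction, MonoidalCategory.tensorHom_def]
    monoidal
  rw [Category.assoc, action_dualComparison h, e, coaction_eq h hs, Category.assoc,
    ← h.frobenius_left]
  have e' := conjugateTensor_comult h
  calc
    _ = (dualComparison A ≫ (mult A)†) ▷ A ≫ (α_ _ _ _).hom ≫ A ◁ mult A := by monoidal
    _ = (conjugateTensor ((mult A)†) ≫ (dualComparison A ⊗ₘ dualComparison A)) ▷ A ≫
          (α_ _ _ _).hom ≫ A ◁ mult A := by rw [e']
    _ = conjugateTensor ((mult A)†) ▷ A ≫ (α_ _ _ _).hom ≫ dual A ◁ dualComparison A ▷ A ≫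
          (dualComparison A ▷ (A ⊗ A) ≫ A ◁ mult A) := by
      rw [tensorHom_def']; monoidal
    _ = _ := by rw [← whisker_exchange]; monoidal

end Frobenius

/-! ### Traces and normalisability -/

section Trace

variable {V : Type u} [Category.{v} V] [MonoidalCategory V] [SymmetricCategory V]
  [LeftRigidCategory V] [DaggerCategory V] [DaggerCompactCategory V]

theorem braiding_slide_effect' (X : V) {P Q : V} (c : P ⊗ Q ⟶ 𝟙_ V) :
    (α_ P Q X).hom ≫ P ◁ (β_ Q X).hom ≫ (α_ P X Q).inv ≫ (β_ P X).hom ▷ Q ≫ (α_ X P Q).hom ≫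
      X ◁ c ≫ (ρ_ X).hom = c ▷ X ≫ (λ_ X).hom := by
  rw [← braiding_slide_effect X c, ← comp_whiskerRight_assoc, SymmetricCategory.symmetry,
    id_whiskerRight, Category.id_comp, Iso.inv_hom_id_assoc, ← whiskerLeft_comp_assoc,
    SymmetricCategory.symmetry, whiskerLeft_id, Category.id_comp, Iso.hom_inv_id_assoc]

/-- Nested pairings of wires. -/
def nestedPairing {P Q : V} (a : P ⊗ Q ⟶ 𝟙_ V) (b : Q ⊗ P ⟶ 𝟙_ V) :
    (P ⊗ Q) ⊗ (P ⊗ Q) ⟶ 𝟙_ V :=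
  (α_ P Q (P ⊗ Q)).hom ≫ P ◁ ((α_ Q P Q).inv ≫ b ▷ Q ≫ (λ_ Q).hom) ≫ a

/-- Swapping the first pair un-nests the pairings to `b ⊗ a`, swapping the second to `a ⊗ b`; the
braiding exchanges the two presentations. -/
theorem nestedPairing_symm {P Q : V} (a : P ⊗ Q ⟶ 𝟙_ V) (b : Q ⊗ P ⟶ 𝟙_ V)
    (hab : (β_ P Q).hom ≫ b = a) :
    (β_ (P ⊗ Q) (P ⊗ Q)).hom ≫ nestedPairing a b = nestedPairing a b := by
  have hba : (β_ Q P).hom ≫ a = b := by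
    rw [← hab, SymmetricCategory.symmetry_assoc]
  have h₁ : (β_ P Q).hom ▷ (P ⊗ Q) ≫ tensorμ Q P P Q ≫ (b ⊗ₘ a) ≫ (λ_ (𝟙_ V)).hom =
      nestedPairing a b := by
    have h := braiding_slide_effect P b
    calc
      _ = 𝟙 _ ⊗≫ ((β_ P Q).hom ▷ P ≫ (α_ _ _ _).hom ≫ Q ◁ (β_ P P).hom ≫ (α_ _ _ _).inv ≫
            b ▷ P ≫ (λ_ P).hom) ▷ Q ⊗≫ a := by
        rw [tensorμ, MonoidalCategory.tensorHom_def]; monoidal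
      _ = _ := by rw [h, nestedPairing]; monoidal
  have h₂ : (P ⊗ Q) ◁ (β_ P Q).hom ≫ tensorμ P Q Q P ≫ (a ⊗ₘ b) ≫ (λ_ (𝟙_ V)).hom =
      nestedPairing a b := by
    have h := braiding_slide_effect' Q b
    calc
      _ = 𝟙 _ ⊗≫ P ◁ ((α_ _ _ _).hom ≫ Q ◁ (β_ P Q).hom ≫ (α_ _ _ _).inv ≫ (β_ Q Q).hom ▷ P ≫
            (α_ _ _ _).hom ≫ Q ◁ b ≫ (ρ_ Q).hom) ⊗≫ a := by
        rw [tensorμ, tensorHom_def']; monoidal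
      _ = _ := by rw [h, nestedPairing]; monoidal
  have h₃ := braiding_tensorμ P Q Q P
  have hn := braiding_naturality_right (P ⊗ Q) (β_ P Q).hom
  rw [← h₁, ← reassoc_of% hn, h₁, reassoc_of% h₃, tensorHom_comp_tensorHom_assoc, hab, hba, h₂]

variable (A : V) [MonObj A]

/-- Left multiplication as a map `A ⟶ A ⊗ A*`. -/
def leftAction : A ⟶ A ⊗ dual A :=
  (ρ_ A).inv ≫ A ◁ (cap A)† ≫ (α_ A A (dual A)).inv ≫ mult A ▷ dual A

theorem multTrace_eq : multTrace A = leftAction A ≫ cap A := by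
  rw [multTrace, partialTrace, cup_braiding, leftAction]
  monoidal

variable {A}

/-- Associativity: left multiplication by a product is the composite of the left multiplications.
The snake equation straightens the wire connecting the two operators. -/
theorem mult_leftAction :
    mult A ≫ leftAction A = (leftAction A ⊗ₘ leftAction A) ≫ (α_ A (dual A) (A ⊗ dual A)).hom ≫
      A ◁ ((α_ (dual A) A (dual A)).inv ≫ (cup A)† ▷ dual A ≫ (λ_ (dual A)).hom) := by
  symm
  calc
    _ = 𝟙 _ ⊗≫ A ◁ leftAction A ⊗≫ A ◁ (cap A)† ▷ A ▷ dual A ⊗≫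
          (mult A ▷ (dual A ⊗ A) ≫ A ◁ (cup A)†) ▷ dual A ⊗≫ 𝟙 _ := by
      rw [tensorHom_def', leftAction.eq_def]; monoidal
    _ = 𝟙 _ ⊗≫ A ◁ leftAction A ⊗≫ A ◁ ((cap A)† ▷ A ≫ (α_ _ _ _).hom ≫ A ◁ (cup A)†) ▷ dual A ⊗≫
          mult A ▷ dual A ⊗≫ 𝟙 _ := by
      rw [← whisker_exchange]; monoidal
    _ = 𝟙 _ ⊗≫ (A ⊗ A) ◁ (cap A)† ⊗≫ ((α_ A A A).hom ≫ A ◁ mult A ≫ mult A) ▷ dual A ⊗≫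
          𝟙 _ := by
      rw [snake_dag, leftAction]; monoidal
    _ = 𝟙 _ ⊗≫ ((A ⊗ A) ◁ (cap A)† ≫ mult A ▷ (A ⊗ dual A)) ⊗≫ mult A ▷ dual A ⊗≫ 𝟙 _ := by
      rw [← mult_assoc]; monoidal
    _ = _ := by rw [whisker_exchange, leftAction]; monoidal

/-- The trace of a product of operators does not depend on their order, applied to left
multiplications. -/
theorem mult_multTrace_symm : (β_ A A).hom ≫ mult A ≫ multTrace A = mult A ≫ multTrace A := by
  have h : mult A ≫ multTrace A =
      (leftAction A ⊗ₘ leftAction A) ≫ nestedPairing (cap A) ((cup A)†) := by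
    rw [multTrace_eq, ← Category.assoc, mult_leftAction, nestedPairing]
    simp only [Category.assoc]
  rw [h, ← braiding_naturality_assoc, nestedPairing_symm _ _ (braiding_cup_dag A)]

theorem multTrace_eq_form (h : IsDaggerFrobenius A) (hs : IsSymmetricForm A) :
    multTrace A = (mult A)† ≫ form A := by
  have e : (cap A)† ≫ A ◁ dualComparison A = coform A := by
    rw [← cup_braiding, Category.assoc, ← braiding_naturality_left, reassoc_of% cup_dualComparison,
      ← Category.assoc, hs.coform]
  rw [multTrace_eq, ← dualComparison_form h, leftAction]
  calc
    _ = (ρ_ A).inv ≫ A ◁ (cap A)† ≫ (α_ A A (dual A)).inv ≫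
          (mult A ▷ dual A ≫ A ◁ dualComparison A) ≫ form A := by simp only [Category.assoc]
    _ = ((ρ_ A).inv ≫ A ◁ ((cap A)† ≫ A ◁ dualComparison A) ≫ (α_ A A A).inv ≫
          mult A ▷ A) ≫ form A := by
      rw [← whisker_exchange]; monoidal
    _ = _ := by rw [e, h.coform_right]

theorem IsCentral.comp {y z : A ⟶ A} (hy : IsCentral y) (hz : IsCentral z) :
    IsCentral (y ≫ z) where
  left := by rw [comp_whiskerRight, Category.assoc, hz.left, ← Category.assoc, hy.left,
    Category.assoc]
  right := by rw [whiskerLeft_comp, Category.assoc, hz.right, ← Category.assoc, hy.right,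
    Category.assoc]

/-- The form is the symmetric trace pairing twisted by `z²`, and centrality allows `z²` to sit on
either input. -/
theorem IsNormalisable.isSymmetricForm (hn : IsNormalisable A) : IsSymmetricForm A := by
  obtain ⟨z, hz, -, e⟩ := hn
  have hzz := hz.comp hz
  have hl : mult A ≫ (unit A)† = (z ≫ z) ▷ A ≫ mult A ≫ multTrace A := by
    rw [reassoc_of% hzz.left, e]
  have hr : mult A ≫ (unit A)† = A ◁ (z ≫ z) ≫ mult A ≫ multTrace A := by
    rw [reassoc_of% hzz.right, e]
  rw [IsSymmetricForm, hl, ← braiding_naturality_right_assoc, mult_multTrace_symm, ← hr, hl]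

theorem isAbstractCStarAlgebra_iff :
    IsAbstractCStarAlgebra A ↔ IsDaggerFrobenius A ∧ IsSymmetricForm A ∧
      ∃ z : A ⟶ A, IsCentral z ∧ IsPositiveDefinite z ∧
        z ≫ z ≫ (mult A)† ≫ mult A ≫ (unit A)† = (unit A)† := by
  constructor
  · rintro ⟨h, hn⟩
    have hs := hn.isSymmetricForm
    obtain ⟨z, hz, hp, e⟩ := hn
    exact ⟨h, hs, z, hz, hp, by rw [← multTrace_eq_form h hs, e]⟩
  · rintro ⟨h, hs, z, hz, hp, e⟩
    exact ⟨h, z, hz, hp, by rw [multTrace_eq_form h hs, e]⟩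

theorem action_double_central (z : A ⟶ A) (hz : IsCentral z) (hd : z† = z) :
    action A ≫ double z = z ≫ z ≫ action A := by
  have hc := cup_conjugate z
  rw [hd] at hc
  -- One `z` comes from the conjugate factor along the cup, the other from the output; centrality
  -- collects both on the right input.
  have hm : z ▷ A ≫ mult A ≫ z = A ◁ z ≫ A ◁ z ≫ mult A := by
    rw [hz.right, reassoc_of% hz.left, reassoc_of% hz.right]
  calc
    _ = (λ_ A).inv ≫ (cup A ≫ conjugate z ▷ A) ▷ A ≫ (α_ _ _ _).hom ≫
          dual A ◁ (mult A ≫ z) := by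
      simp only [action, double, tensorHom_def', Category.assoc]
      rw [← whiskerLeft_comp_assoc, whisker_exchange]
      monoidal
    _ = (λ_ A).inv ≫ cup A ▷ A ≫ (α_ _ _ _).hom ≫ dual A ◁ (z ▷ A ≫ mult A ≫ z) := by
      rw [hc]; monoidal
    _ = (λ_ A).inv ≫ (cup A ▷ A ≫ (dual A ⊗ A) ◁ (z ≫ z)) ≫ (α_ _ _ _).hom ≫
          dual A ◁ mult A := by
      rw [hm]; monoidal
    _ = _ := by rw [← whisker_exchange, action]; monoidal

/-- The action is an isometry up to a positive definite map. -/
theorem exists_action_double_coaction (hA : IsAbstractCStarAlgebra A) :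
    ∃ z : A ⟶ A, action A ≫ double z ≫ coaction A = 𝟙 A := by
  obtain ⟨h, hs, z, hz, hp, e⟩ := isAbstractCStarAlgebra_iff.1 hA
  refine ⟨z, ?_⟩
  rw [← Category.assoc, action_double_central z hz hp.1.dag_eq, Category.assoc, Category.assoc,
    action_coaction h hs]
  -- The map `w` is to be shown to be the identity. It commutes with right multiplication and
  -- preserves the counit, hence preserves the form in its first argument.
  set w := z ≫ z ≫ (mult A)† ≫ mult A with hw
  have hzz := hz.comp hz
  have h₁ : w ▷ A ≫ mult A = mult A ≫ w := by
    have hw' : w = (z ≫ z) ≫ (mult A)† ≫ mult A := by rw [hw, Category.assoc]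
    rw [hw', comp_whiskerRight (z ≫ z), comp_whiskerRight ((mult A)†), Category.assoc,
      Category.assoc, mult_assoc,
      reassoc_of% h.frobenius_left, ← Category.assoc (mult A) (z ≫ z), ← hzz.left, Category.assoc]
  have h₂ : w ▷ A ≫ form A = form A := by
    rw [form, reassoc_of% h₁, hw]
    simp only [Category.assoc, e]
  -- Nondegeneracy: a map is recovered from the form via the copairing, by `snake_form`.
  rw [← cancel_epi (ρ_ A).hom, ← rightUnitor_naturality, Category.comp_id]
  calc
    _ = (w ▷ 𝟙_ V ≫ A ◁ coform A) ≫ (α_ A A A).inv ≫ form A ▷ A ≫ (λ_ A).hom := by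
      rw [← h.snake_form, Category.assoc]
    _ = A ◁ coform A ≫ (α_ A A A).inv ≫ (w ▷ A ≫ form A) ▷ A ≫ (λ_ A).hom := by
      rw [← whisker_exchange]; monoidal
    _ = _ := by rw [h₂, h.snake_form]

end Trace

/-! ### Monoidal products of algebras -/

section Tensor

variable {V : Type u} [Category.{v} V] [MonoidalCategory V] [SymmetricCategory V]
  [LeftRigidCategory V] [DaggerCategory V] [DaggerCompactCategory V]

theorem IsPositiveDefinite.tensor {A B : V} {f : A ⟶ A} {g : B ⟶ B}
    (hf : IsPositiveDefinite f) (hg : IsPositiveDefinite g) : IsPositiveDefinite (f ⊗ₘ g) := by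
  obtain ⟨⟨Y, h, rfl⟩, h₁⟩ := hf
  obtain ⟨⟨Z, k, rfl⟩, h₂⟩ := hg
  exact ⟨⟨Y ⊗ Z, h ⊗ₘ k, by simp⟩, inferInstance⟩

theorem isPositiveDefinite_id (A : V) : IsPositiveDefinite (𝟙 A) :=
  ⟨⟨A, 𝟙 A, by simp⟩, inferInstance⟩

variable (V) in
theorem unit_isAbstractCStarAlgebra : IsAbstractCStarAlgebra (𝟙_ V) := by
  have hm : mult (𝟙_ V) = (λ_ (𝟙_ V)).hom := rfl
  have hu : unit (𝟙_ V) = 𝟙 (𝟙_ V) := rfl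
  rw [isAbstractCStarAlgebra_iff]
  refine ⟨⟨?_, ?_⟩, ?_, 𝟙 _, ⟨?_, ?_⟩, isPositiveDefinite_id _, ?_⟩
  · rw [hm, dag_leftUnitor_hom]; monoidal
  · rw [hm, dag_leftUnitor_hom]; monoidal
  · rw [IsSymmetricForm, hm, ← Category.assoc, braiding_leftUnitor, unitors_equal]
  · simp
  · simp
  · rw [hm, hu]; simp

variable {A B : V} [MonObj A] [MonObj B]

theorem mult_tensor : mult (A ⊗ B) = tensorμ A B A B ≫ (mult A ⊗ₘ mult B) := rfl

theorem unit_tensor : unit (A ⊗ B) = (λ_ (𝟙_ V)).inv ≫ (unit A ⊗ₘ unit B) := rfl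

theorem mult_tensor_dag :
    (mult (A ⊗ B))† = ((mult A)† ⊗ₘ (mult B)†) ≫ tensorμ A A B B := by
  rw [mult_tensor]; simp

theorem unit_tensor_dag :
    (unit (A ⊗ B))† = ((unit A)† ⊗ₘ (unit B)†) ≫ (λ_ (𝟙_ V)).hom := by
  rw [unit_tensor]; simp

theorem tensorμ_whiskerLeft (X Y : V) {X₁ X₂ Y₁ Y₂ : V} (f : X₁ ⟶ X₂) (g : Y₁ ⟶ Y₂) :
    (X ◁ f ⊗ₘ Y ◁ g) ≫ tensorμ X X₂ Y Y₂ = tensorμ X X₁ Y Y₁ ≫ (X ⊗ Y) ◁ (f ⊗ₘ g) := by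
  have h := tensorμ_natural (𝟙 X) f (𝟙 Y) g
  rwa [id_tensorHom_id, id_tensorHom, id_tensorHom, id_tensorHom] at h

theorem tensorμ_whiskerRight {X₁ X₂ Y₁ Y₂ : V} (f : X₁ ⟶ X₂) (g : Y₁ ⟶ Y₂) (X Y : V) :
    (f ▷ X ⊗ₘ g ▷ Y) ≫ tensorμ X₂ X Y₂ Y = tensorμ X₁ X Y₁ Y ≫ (f ⊗ₘ g) ▷ (X ⊗ Y) := by
  have h := tensorμ_natural f (𝟙 X) g (𝟙 Y)
  rwa [id_tensorHom_id, tensorHom_id, tensorHom_id, tensorHom_id] at h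

/-- The associativity coherence of `tensorμ` with two shuffles moved across by their inverses, as
the Frobenius law of a product algebra needs it. -/
theorem tensorμ_frobenius (X₁ X₂ Y₁ Y₂ Z₁ Z₂ : V) :
    tensorμ X₁ Y₁ X₂ Y₂ ▷ (Z₁ ⊗ Z₂) ≫ (α_ (X₁ ⊗ X₂) (Y₁ ⊗ Y₂) (Z₁ ⊗ Z₂)).hom ≫
      (X₁ ⊗ X₂) ◁ tensorμ Y₁ Y₂ Z₁ Z₂ =
    tensorμ (X₁ ⊗ Y₁) (X₂ ⊗ Y₂) Z₁ Z₂ ≫ ((α_ X₁ Y₁ Z₁).hom ⊗ₘ (α_ X₂ Y₂ Z₂).hom) ≫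
      tensorμ X₁ (Y₁ ⊗ Z₁) X₂ (Y₂ ⊗ Z₂) := by
  have h := tensor_associativity X₁ X₂ Y₁ Y₂ Z₁ Z₂ =≫ tensorμ X₁ (Y₁ ⊗ Z₁) X₂ (Y₂ ⊗ Z₂)
  have h' := tensorμ X₁ Y₁ X₂ Y₂ ▷ (Z₁ ⊗ Z₂) ≫= h
  simp only [Category.assoc, tensorμ_tensorμ, Category.comp_id] at h'
  rw [← comp_whiskerRight_assoc, tensorμ_tensorμ, id_whiskerRight, Category.id_comp] at h'
  exact h'.symm

theorem tensorμ_frobenius' (X₁ X₂ Y₁ Y₂ Z₁ Z₂ : V) :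
    (X₁ ⊗ X₂) ◁ tensorμ Y₁ Z₁ Y₂ Z₂ ≫ (α_ (X₁ ⊗ X₂) (Y₁ ⊗ Y₂) (Z₁ ⊗ Z₂)).inv ≫
      tensorμ X₁ X₂ Y₁ Y₂ ▷ (Z₁ ⊗ Z₂) =
    tensorμ X₁ X₂ (Y₁ ⊗ Z₁) (Y₂ ⊗ Z₂) ≫ ((α_ X₁ Y₁ Z₁).inv ⊗ₘ (α_ X₂ Y₂ Z₂).inv) ≫
      tensorμ (X₁ ⊗ Y₁) Z₁ (X₂ ⊗ Y₂) Z₂ := by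
  have h := congrArg (fun f => f†) (tensorμ_frobenius X₁ X₂ Y₁ Y₂ Z₁ Z₂)
  simpa using h

theorem tensor_isAbstractCStarAlgebra (hA : IsAbstractCStarAlgebra A)
    (hB : IsAbstractCStarAlgebra B) : IsAbstractCStarAlgebra (A ⊗ B) := by
  obtain ⟨fA, sA, z, hz, pz, eA⟩ := isAbstractCStarAlgebra_iff.1 hA
  obtain ⟨fB, sB, w, hw, pw, eB⟩ := isAbstractCStarAlgebra_iff.1 hB
  rw [isAbstractCStarAlgebra_iff]
  refine ⟨⟨?_, ?_⟩, ?_, z ⊗ₘ w, ⟨?_, ?_⟩, pz.tensor pw, ?_⟩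
  · rw [mult_tensor_dag, mult_tensor, comp_whiskerRight, whiskerLeft_comp, Category.assoc,
      reassoc_of% tensorμ_frobenius A B A B A B, reassoc_of% tensorμ_natural_left,
      ← tensorμ_whiskerLeft]
    simp only [tensorHom_comp_tensorHom_assoc, fA.frobenius_left, fB.frobenius_left]
    simp
  · rw [mult_tensor_dag, mult_tensor, comp_whiskerRight, whiskerLeft_comp, Category.assoc,
      reassoc_of% tensorμ_frobenius' A B A B A B, reassoc_of% tensorμ_natural_right,
      ← tensorμ_whiskerRight]
    simp only [tensorHom_comp_tensorHom_assoc, fA.frobenius_right, fB.frobenius_right]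
    simp
  · rw [IsSymmetricForm, mult_tensor, unit_tensor_dag, Category.assoc,
      reassoc_of% braiding_tensorμ A B A B]
    simp only [tensorHom_comp_tensorHom_assoc]
    rw [sA, sB]
  · rw [mult_tensor, tensorμ_natural_left_assoc, tensorHom_comp_tensorHom, hz.left, hw.left,
      Category.assoc, tensorHom_comp_tensorHom]
  · rw [mult_tensor, tensorμ_natural_right_assoc, tensorHom_comp_tensorHom, hz.right, hw.right,
      Category.assoc, tensorHom_comp_tensorHom]
  · rw [mult_tensor_dag, mult_tensor, unit_tensor_dag]
    simp only [Category.assoc, reassoc_of% tensorμ_tensorμ, tensorHom_comp_tensorHom_assoc, eA, eB]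

/-- The cup of `A ⊗ B` is a shuffled pair of cups followed by `conjTensor`; coherence matches its
shuffle with the one in the product multiplication. -/
theorem action_tensor : action (A ⊗ B) = (action A ⊗ₘ action B) ≫ doubleTensor A B := by
  have h₁ := associator_monoidal (dual A) A A (dual B) B B
  have h₄ : ((λ_ A).inv ⊗ₘ (λ_ B).inv) ≫ tensorμ (𝟙_ V) A (𝟙_ V) B =
      (λ_ (A ⊗ B)).inv ≫ (λ_ (𝟙_ V)).inv ▷ (A ⊗ B) := by
    have h := congrArg (fun f => f†) (leftUnitor_monoidal A B)
    have h' := h =≫ tensorμ (𝟙_ V) A (𝟙_ V) B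
    simpa using h'
  have h₅ : cup (A ⊗ B) = (λ_ (𝟙_ V)).inv ≫ (cup A ⊗ₘ cup B) ≫ tensorμ (dual A) A (dual B) B ≫
      conjTensor A B ▷ (A ⊗ B) := by
    rw [cup_conjTensor, Iso.inv_hom_id_assoc]
  have h₁' := h₁ =≫ ((dual A ⊗ dual B) ◁ tensorμ A B A B)
  simp only [Category.assoc, ← whiskerLeft_comp, tensorμ_tensorμ] at h₁'
  rw [whiskerLeft_id, Category.comp_id] at h₁'
  simp only [action, doubleTensor, ← tensorHom_comp_tensorHom, Category.assoc]
  rw [reassoc_of% tensorμ_whiskerLeft, ← reassoc_of% h₁', reassoc_of% tensorμ_whiskerRight, reassoc_of% h₄,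
    mult_tensor]
  simp only [h₅, comp_whiskerRight, whiskerLeft_comp, Category.assoc]
  rw [associator_naturality_left_assoc, ← whisker_exchange_assoc, ← whisker_exchange]

theorem cpStar_tensor {C D : V} [MonObj C] [MonObj D] {f : A ⟶ B} {g : C ⟶ D} (hf : IsCPStar f)
    (hg : IsCPStar g) : IsCPStar (f ⊗ₘ g) := by
  have h : IsCPM (cpmTensor (coaction A ≫ f ≫ action B) (coaction C ≫ g ≫ action D)) :=
    IsCPM.tensor hf hg
  have e : coaction (A ⊗ C) ≫ (f ⊗ₘ g) ≫ action (B ⊗ D) =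
      cpmTensor (coaction A ≫ f ≫ action B) (coaction C ≫ g ≫ action D) := by
    rw [coaction_eq_dag, action_tensor, action_tensor, cpmTensor, coaction_eq_dag,
      coaction_eq_dag]
    simp
  rw [← e] at h
  exact h

end Tensor

/-! ### Closure properties of the CP*-condition -/

section Closure

variable {V : Type u} [Category.{v} V] [MonoidalCategory V] [SymmetricCategory V]
  [LeftRigidCategory V] [DaggerCategory V] [DaggerCompactCategory V]

theorem isCPStar_iff {A B : V} [MonObj A] [MonObj B] {f : A ⟶ B} :
    IsCPStar f ↔ IsCPM (coaction A ≫ f ≫ action B) := Iff.rfl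

/-- A unitary homomorphism intertwines the actions, so its CP*-form is the one of the identity
followed by a doubled map. Identities and coherence isomorphisms are all covered. -/
theorem isCPStar_of_unitary {A B : V} [MonObj A] [MonObj B] (hA : IsAbstractCStarAlgebra A)
    {f : A ⟶ B} (hf : IsUnitary f) [IsMonHom f] : IsCPStar f := by
  obtain ⟨h, hs, -⟩ := isAbstractCStarAlgebra_iff.1 hA
  rw [isCPStar_iff, ← action_double hf (IsMonHom.mul_hom f), ← Category.assoc,
    coaction_action h hs]
  exact IsCPM.comp ⟨_, _, rfl⟩ (isCPM_double f)

theorem isCPStar_dag {A B : V} [MonObj A] [MonObj B] {f : A ⟶ B} (hf : IsCPStar f) :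
    IsCPStar (f†) := by
  have h := IsCPM.dag (isCPStar_iff.1 hf)
  simpa [isCPStar_iff, coaction_eq_dag] using h

theorem isCPStar_comp {A B C : V} [MonObj A] [MonObj B] [MonObj C]
    (hB : IsAbstractCStarAlgebra B) {f : A ⟶ B} {g : B ⟶ C} (hf : IsCPStar f)
    (hg : IsCPStar g) : IsCPStar (f ≫ g) := by
  obtain ⟨z, hz⟩ := exists_action_double_coaction hB
  -- Inserting the doubled normaliser between the two maps lets the middle action and coaction
  -- cancel.
  have h := (IsCPM.comp (isCPStar_iff.1 hf) (isCPM_double z)).comp (isCPStar_iff.1 hg)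
  simp only [Category.assoc, reassoc_of% hz] at h
  simpa only [isCPStar_iff, Category.assoc] using h

open DaggerSymmetricMonoidalCategory

variable (V) in
theorem cpStarWellDefined : CPStarWellDefined V where
  id_mem A := isCPStar_of_unitary A.isAlgebra (isUnitary_id _)
  comp_mem {_ B _} _ _ hf hg := isCPStar_comp B.isAlgebra hf hg
  dag_mem _ hf := isCPStar_dag hf
  unit_isAlgebra := unit_isAbstractCStarAlgebra V
  tensor_isAlgebra A B := tensor_isAbstractCStarAlgebra A.isAlgebra B.isAlgebra
  tensor_mem _ _ hf hg := cpStar_tensor hf hg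
  associator_mem A B C := isCPStar_of_unitary (tensor_isAbstractCStarAlgebra
    (tensor_isAbstractCStarAlgebra A.isAlgebra B.isAlgebra) C.isAlgebra) (unitary_associator _ _ _)
  associator_inv_mem A B C := by
    rw [← dag_associator_hom]
    exact isCPStar_dag (isCPStar_of_unitary (tensor_isAbstractCStarAlgebra
      (tensor_isAbstractCStarAlgebra A.isAlgebra B.isAlgebra) C.isAlgebra)
        (unitary_associator _ _ _))
  leftUnitor_mem A := isCPStar_of_unitary (tensor_isAbstractCStarAlgebra
    (unit_isAbstractCStarAlgebra V) A.isAlgebra) (unitary_leftUnitor _)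
  leftUnitor_inv_mem A := by
    rw [← dag_leftUnitor_hom]
    exact isCPStar_dag (isCPStar_of_unitary (tensor_isAbstractCStarAlgebra
      (unit_isAbstractCStarAlgebra V) A.isAlgebra) (unitary_leftUnitor _))
  rightUnitor_mem A := isCPStar_of_unitary (tensor_isAbstractCStarAlgebra
    A.isAlgebra (unit_isAbstractCStarAlgebra V)) (unitary_rightUnitor _)
  rightUnitor_inv_mem A := by
    rw [← dag_rightUnitor_hom]
    exact isCPStar_dag (isCPStar_of_unitary (tensor_isAbstractCStarAlgebra
      A.isAlgebra (unit_isAbstractCStarAlgebra V)) (unitary_rightUnitor _))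
  braiding_mem A B := isCPStar_of_unitary (tensor_isAbstractCStarAlgebra
    A.isAlgebra B.isAlgebra) (unitary_braiding _ _)

end Closure

/-! ### Matrix algebras -/

section Matrix

variable {V : Type u} [Category.{v} V] [MonoidalCategory V] [SymmetricCategory V]
  [LeftRigidCategory V] [DaggerCategory V] [DaggerCompactCategory V]

theorem scalar_comm (s t : 𝟙_ V ⟶ 𝟙_ V) : s ≫ t = t ≫ s := by
  calc
    _ = 𝟙 _ ⊗≫ (s ▷ 𝟙_ V ≫ 𝟙_ V ◁ t) ⊗≫ 𝟙 _ := by monoidal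
    _ = _ := by rw [← whisker_exchange]; monoidal

theorem dimension_eq (X : V) : dimension X = (cap X)† ≫ cap X := by
  rw [dimension, partialTrace, cup_braiding]
  monoidal

theorem pantsMult_dag (H : V) :
    (pantsMult H)† = dual H ◁ ((λ_ H).inv ≫ (cap H)† ▷ H ≫ (α_ H (dual H) H).hom) ≫
      (α_ (dual H) H (dual H ⊗ H)).inv := by
  simp [pantsMult]

theorem pants_isDaggerFrobenius (H : V) :
    @IsDaggerFrobenius V _ _ _ (dual H ⊗ H) (pantsMonObj H) := by
  let _ := pantsMonObj H
  have hm : mult (dual H ⊗ H) = pantsMult H := rfl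
  constructor
  · rw [hm, pantsMult_dag, pantsMult]
    calc
      _ = 𝟙 _ ⊗≫ dual H ◁ ((cap H)† ▷ (H ⊗ dual H) ≫ (H ⊗ dual H) ◁ cap H) ▷ H ⊗≫ 𝟙 _ := by
        monoidal
      _ = _ := by rw [← whisker_exchange]; monoidal
  · rw [hm, pantsMult_dag, pantsMult]
    calc
      _ = 𝟙 _ ⊗≫ dual H ◁ ((H ⊗ dual H) ◁ (cap H)† ≫ cap H ▷ (H ⊗ dual H)) ▷ H ⊗≫ 𝟙 _ := by
        monoidal
      _ = _ := by rw [whisker_exchange]; monoidal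

/-- The form of the matrix algebra is a nested pairing of `(cup H)†` and `cap H`, which the braiding
interchanges. -/
theorem pants_isSymmetricForm (H : V) :
    @IsSymmetricForm V _ _ _ _ (dual H ⊗ H) (pantsMonObj H) := by
  let _ := pantsMonObj H
  have h := nestedPairing_symm _ _ (braiding_cap H)
  have e : mult (dual H ⊗ H) ≫ (unit (dual H ⊗ H))† = nestedPairing ((cup H)†) (cap H) := by
    change pantsMult H ≫ (cup H)† = _
    rw [pantsMult, nestedPairing]
    simp only [Category.assoc]
  rw [IsSymmetricForm, e]
  exact h

/-- Multiplication by a scalar on the second factor of `H* ⊗ H`. -/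
def scalarRight (H : V) (z : 𝟙_ V ⟶ 𝟙_ V) : dual H ⊗ H ⟶ dual H ⊗ H :=
  dual H ◁ ((λ_ H).inv ≫ z ▷ H ≫ (λ_ H).hom)

theorem scalarRight_comp (H : V) (s t : 𝟙_ V ⟶ 𝟙_ V) :
    scalarRight H s ≫ scalarRight H t = scalarRight H (s ≫ t) := by
  simp [scalarRight]

theorem scalarRight_positiveDefinite (H : V) {z : 𝟙_ V ⟶ 𝟙_ V} (hz : IsPositiveDefinite z) :
    IsPositiveDefinite (scalarRight H z) := by
  obtain ⟨⟨Y, h, rfl⟩, hi⟩ := hz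
  refine ⟨⟨dual H ⊗ Y ⊗ H, dual H ◁ ((λ_ H).inv ≫ h ▷ H), ?_⟩, ?_⟩
  · simp [scalarRight]
  · rw [scalarRight]; infer_instance

theorem scalarRight_isCentral (H : V) (z : 𝟙_ V ⟶ 𝟙_ V) :
    @IsCentral V _ _ (dual H ⊗ H) (pantsMonObj H) (scalarRight H z) := by
  let _ := pantsMonObj H
  have hm : mult (dual H ⊗ H) = pantsMult H := rfl
  constructor
  · rw [hm, pantsMult, scalarRight]
    calc
      _ = 𝟙 _ ⊗≫ dual H ◁ (z ▷ (H ⊗ dual H) ≫ 𝟙_ V ◁ cap H) ▷ H ⊗≫ 𝟙 _ := by monoidal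
      _ = _ := by rw [← whisker_exchange]; monoidal
  · rw [hm, pantsMult, scalarRight]
    calc
      _ = 𝟙 _ ⊗≫ dual H ◁ ((H ⊗ dual H) ◁ z ≫ cap H ▷ 𝟙_ V) ▷ H ⊗≫ 𝟙 _ := by monoidal
      _ = _ := by rw [whisker_exchange]; monoidal

theorem pantsMult_dag_comp (H : V) :
    (pantsMult H)† ≫ pantsMult H = scalarRight H (dimension H) := by
  rw [pantsMult_dag, pantsMult, scalarRight, dimension_eq]
  monoidal

theorem hasMatrixAlgebras (hV : IsPositiveDimensional V) : HasMatrixAlgebras V := by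
  intro H
  let _ := pantsMonObj H
  obtain ⟨z, hz, e⟩ := hV H
  rw [isAbstractCStarAlgebra_iff]
  -- The normaliser is the scalar from positive-dimensionality: its square cancels the loop produced
  -- by `m† ≫ m`.
  refine ⟨pants_isDaggerFrobenius H, pants_isSymmetricForm H, scalarRight H z,
    scalarRight_isCentral H z, scalarRight_positiveDefinite H hz, ?_⟩
  have h : scalarRight H z ≫ scalarRight H z ≫ (pantsMult H)† ≫ pantsMult H = 𝟙 _ := by
    rw [pantsMult_dag_comp, scalarRight_comp, scalarRight_comp, ← Category.assoc,
      scalar_comm, scalarRight, e]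
    simp
  have hm : mult (dual H ⊗ H) = pantsMult H := rfl
  rw [hm, reassoc_of% h]

/-- The cup of `A* ⊗ A` splits into cups of `A*` and `A`. The cup of `A` is straightened against the
cap in the multiplication, leaving only the state `cup (dual A)` adjoined by the dagger of a
discard. -/
theorem pants_action (A : V) :
    @action V _ _ _ (dual A ⊗ A) (pantsMonObj A) = (discard (dual A) A)† := by
  let _ := pantsMonObj A
  have hm : mult (dual A ⊗ A) = pantsMult A := rfl
  have hc : cup (dual A ⊗ A) = (λ_ (𝟙_ V)).inv ≫ (cup (dual A) ⊗ₘ cup A) ≫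
      tensorμ (dual (dual A)) (dual A) (dual A) A ≫ conjTensor (dual A) A ▷ (dual A ⊗ A) := by
    rw [cup_conjTensor, Iso.inv_hom_id_assoc]
  have h : (λ_ (dual A ⊗ A)).inv ≫ ((λ_ (𝟙_ V)).inv ≫ (cup (dual A) ⊗ₘ cup A) ≫
      tensorμ (dual (dual A)) (dual A) (dual A) A) ▷ (dual A ⊗ A) ≫ (α_ _ _ _).hom ≫
      (dual (dual A) ⊗ dual A) ◁ pantsMult A =
      (λ_ (dual A ⊗ A)).inv ≫ cup (dual A) ▷ (dual A ⊗ A) ≫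
        tensorμ (dual (dual A)) (dual A) (dual A) A := by
    calc
      _ = 𝟙 _ ⊗≫ cup (dual A) ▷ dual A ▷ A ⊗≫ (dual (dual A) ⊗ dual A) ◁ cup A ▷ dual A ▷ A ⊗≫
            dual (dual A) ◁ ((β_ (dual A) (dual A)).hom ▷ (A ⊗ dual A) ≫
              (dual A ⊗ dual A) ◁ cap A) ▷ A ⊗≫ 𝟙 _ := by
        rw [tensorμ, pantsMult, MonoidalCategory.tensorHom_def]; monoidal
      _ = 𝟙 _ ⊗≫ cup (dual A) ▷ dual A ▷ A ⊗≫ (dual (dual A) ⊗ dual A) ◁ (cup A ▷ dual A ≫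
            (α_ _ _ _).hom ≫ dual A ◁ cap A) ▷ A ⊗≫
            dual (dual A) ◁ (β_ (dual A) (dual A)).hom ▷ A ⊗≫ 𝟙 _ := by
        rw [← whisker_exchange]; monoidal
      _ = _ := by rw [snake_dual, tensorμ]; monoidal
  rw [action, hm, hc, discard, doubleTensor]
  simp only [DaggerCategory.dag_comp, DaggerCategory.dag_dag, dag_whiskerRight,
    dag_leftUnitor_hom, Category.assoc, comp_whiskerRight] at h ⊢
  rw [associator_naturality_left_assoc, ← whisker_exchange, reassoc_of% h]

theorem pants_coaction (A : V) :
    @coaction V _ _ _ _ (dual A ⊗ A) (pantsMonObj A) = discard (dual A) A := by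
  let _ := pantsMonObj A
  rw [coaction_eq_dag, pants_action, DaggerCategory.dag_dag]

theorem isCPM_pants_action (A : V) :
    IsCPM (@action V _ _ _ (dual A ⊗ A) (pantsMonObj A)) := by
  rw [pants_action]
  exact isCPM_discard_dag _ _

theorem isCPM_pants_coaction (A : V) :
    IsCPM (@coaction V _ _ _ _ (dual A ⊗ A) (pantsMonObj A)) := by
  rw [pants_coaction]
  exact isCPM_discard _ _

theorem isCPStar_double (hB : HasMatrixAlgebras V) {A B : V} (f : A ⟶ B) :
    IsCPStar (A := (matrixAlgebra hB A).X) (B := (matrixAlgebra hB B).X) (double f) :=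
  (isCPM_pants_coaction A).comp ((isCPM_double f).comp (isCPM_pants_action B))

/-! ### Structure maps of the functor in `CP*[V]` -/

theorem action_unit : action (𝟙_ V) = cup (𝟙_ V) := by
  have hm : mult (𝟙_ V) = (λ_ (𝟙_ V)).hom := rfl
  rw [action, hm]
  monoidal

/-- The coaction of the unit algebra is the inverse of this unitary cup, so the CP*-form is just the
action of the matrix algebra. -/
theorem isCPStar_cup_unit (hB : HasMatrixAlgebras V) :
    IsCPStar (A := 𝟙_ V) (B := (matrixAlgebra hB (𝟙_ V)).X) (cup (𝟙_ V)) := by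
  have h := isCPM_pants_action (𝟙_ V)
  rw [← Category.id_comp (@action _ _ _ _ (dual (𝟙_ V) ⊗ 𝟙_ V) (pantsMonObj _)),
    ← (isUnitary_cup_unit V).dag_comp, Category.assoc] at h
  change IsCPM (coaction (𝟙_ V) ≫ _)
  rw [coaction_eq_dag, action_unit]
  exact h

/-- By `action_tensor`, the comparison cancels its dagger in the coaction of the product, leaving
the product of two completely positive coactions. -/
theorem isCPStar_doubleTensor (hB : HasMatrixAlgebras V) (A B : V) :
    IsCPStar (A := (matrixAlgebra hB A).X ⊗ (matrixAlgebra hB B).X)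
      (B := (matrixAlgebra hB (A ⊗ B)).X) (doubleTensor A B) := by
  let _ := pantsMonObj A
  let _ := pantsMonObj B
  let _ := pantsMonObj (A ⊗ B)
  have e : coaction ((dual A ⊗ A) ⊗ (dual B ⊗ B)) ≫ doubleTensor A B =
      cpmTensor (coaction (dual A ⊗ A)) (coaction (dual B ⊗ B)) := by
    rw [coaction_eq_dag, action_tensor, cpmTensor, coaction_eq_dag, coaction_eq_dag]
    simp
  have h : IsCPM (coaction ((dual A ⊗ A) ⊗ (dual B ⊗ B)) ≫ doubleTensor A B ≫
      action (dual (A ⊗ B) ⊗ (A ⊗ B))) := by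
    rw [← Category.assoc, e]
    exact (IsCPM.tensor (isCPM_pants_coaction A) (isCPM_pants_coaction B)).comp
      (isCPM_pants_action (A ⊗ B))
  exact h

variable [CPStarWellDefined V]

/-- The monoidal structure of the functor of matrix algebras. -/
def pureFunctorCore (hB : HasMatrixAlgebras V) :
    (pureFunctor hB (isCPStar_double hB)).CoreMonoidal where
  εIso := CPStar.mkIso (isUnitary_cup_unit V).iso (isCPStar_cup_unit hB)
    (isCPStar_dag (isCPStar_cup_unit hB))
  μIso A B := CPStar.mkIso (isUnitary_doubleTensor A B).iso (isCPStar_doubleTensor hB A B)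
    (isCPStar_dag (isCPStar_doubleTensor hB A B))
  μIso_hom_natural_left f A :=
    CPStar.hom_ext (Functor.LaxMonoidal.μ_natural_left (doubleFunctor V) f A)
  μIso_hom_natural_right A f :=
    CPStar.hom_ext (Functor.LaxMonoidal.μ_natural_right (doubleFunctor V) A f)
  associativity A B C := CPStar.hom_ext (doubleTensor_associativity A B C)
  left_unitality A := CPStar.hom_ext (doubleTensor_left_unitality A)
  right_unitality A := CPStar.hom_ext (doubleTensor_right_unitality A)

theorem pureFunctor_daggerSymmetricMonoidal (hB : HasMatrixAlgebras V) :
    Nonempty (DaggerSymmetricMonoidalFunctor (pureFunctor hB (isCPStar_double hB))) :=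
  ⟨{ (pureFunctorCore hB).toMonoidal with
      braided := fun A B => CPStar.hom_ext (doubleTensor_braiding A B)
      map_dag := fun f => CPStar.hom_ext (double_dag f)
      unitary_unit := ⟨CPStar.hom_ext (isUnitary_cup_unit V).comp_dag,
        CPStar.hom_ext (isUnitary_cup_unit V).dag_comp⟩
      unitary_tensor := fun A B => ⟨CPStar.hom_ext (isUnitary_doubleTensor A B).comp_dag,
        CPStar.hom_ext (isUnitary_doubleTensor A B).dag_comp⟩ }⟩

end Matrix

end DaggerCompact

open DaggerCompact in
theorem mainTheorem9 (V : Type u) [Category.{v} V] [MonoidalCategory V] [SymmetricCategory V]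
    [LeftRigidCategory V] [DaggerCategory V] [DaggerCompactCategory V]
    (hV : IsPositiveDimensional V) :
    ∃ (_ : CPStarWellDefined V) (hB : HasMatrixAlgebras V)
      (hf : ∀ {A B : V} (f : A ⟶ B),
        IsCPStar (A := (matrixAlgebra hB A).X) (B := (matrixAlgebra hB B).X) (double f)),
      Nonempty (DaggerSymmetricMonoidalFunctor (pureFunctor hB hf)) := by
  have hW := cpStarWellDefined V
  have hB := hasMatrixAlgebras hV
  exact ⟨hW, hB, isCPStar_double hB, pureFunctor_daggerSymmetricMonoidal hB⟩
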